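/- Let $n\ge 1$ and let $\mathfrak L_j=\{|\zeta-\zeta_j|=r_j\}$, $r_j>0$, $j=0,\dots,n-1$, be circles in $\mathbb C$ bounding pairwise disjoint closed discs, oriented counterclockwise; let $\mathfrak L=\bigcup_j\mathfrak L_j$ and let $\mathfrak D^e\ni\infty$ be the exterior of all these discs in $\overline{\mathbb C}$. Put $T_j(\zeta)=\zeta_j+r_j^2/(\overline\zeta-\overline{\zeta_j})$ and $\sigma_j=T_jT_0$, let $\mathfrak G$ be the group of transformations of $\overline{\mathbb C}$ generated by $\sigma_0,\dots,\sigma_{n-1}$, and let $\Omega'=\bigcup_{\sigma\in\mathfrak G}\sigma(\mathfrak D^e\cup T_0(\mathfrak D^e))$. Writing $\sigma(\zeta)=(\alpha_\sigma\zeta+\beta_\sigma)/(\gamma_\sigma\zeta+\delta_\sigma)$, assume $$\sum_{\sigma\in\mathfrak G,\ \sigma\ne \mathrm{id}}\frac{|\alpha_\sigma\delta_\sigma-\beta_\sigma\gamma_\sigma|}{|\gamma_\sigma|^2}<\infty .$$ Fix $\zeta_*\in\mathfrak D^e$ and $c\in\mathbb C$. For $\zeta\in\Omega'$ and $\eta\in\mathfrak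 L$ let $$\mathcal K(\zeta,\eta)=\sum_{\sigma\in\mathfrak G}\Big(\frac1{\sigma(\eta)-\zeta}-\frac1{\sigma(\eta)-\zeta_*}\Big)\sigma'(\eta),\qquad \chi_\sigma(\eta)=\mathcal K(\sigma(\zeta_*),\eta)\quad(\sigma\in\mathfrak G),$$ where $1/(w-\infty)=0$, and for $a_0,\dots,a_{n-1},C_1\in\mathbb R$ let $$\Psi_1(\zeta)=\frac1{2\pi}\sum_{j=0}^{n-1}\int_{\mathfrak L_j}[\operatorname{Im}(c\eta)-a_j]\,\mathcal K(\zeta,\eta)\,d\eta,\qquad \Phi_1(\zeta)=\Psi_1(\zeta)+\overline{\Psi_1(T_0(\zeta))}+C_1 .$$ Then: (i) The series for $\mathcal K(\zeta,\eta)$ converges absolutely, $\mathcal K(\zeta,\cdot)$ is integrable on each $\mathfrak L_l$, and $\mathcal K(\sigma(\zeta),\eta)=\mathcal K(\zeta,\eta)+\chi_\sigma(\eta)$ for all $\sigma\in\mathfrak G$, $\zeta\in\Omega'$, $\eta\in\mathfrak L$. (ii) $\int_{\mathfrak L_0}\chi_{\sigma_j}(\eta)\,d\eta=-2\pi i$ and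 $\int_{\mathfrak L_l}\chi_{\sigma_j}(\eta)\,d\eta=2\pi i\,\delta_{lj}$ for $j,l=1,\dots,n-1$. (iii) For all real $a_0,\dots,a_{n-1},C_1$, the function $\Phi_1$ is $\mathfrak G$-automorphic, that is, $\Phi_1(\sigma(\zeta))=\Phi_1(\zeta)$ for all $\sigma\in\mathfrak G$, $\zeta\in\Omega'$, if and only if $$a_j=a_0+\frac1{2\pi}\operatorname{Im}\sum_{l=0}^{n-1}\int_{\mathfrak L_l}\operatorname{Im}(c\eta)\,\chi_{\sigma_j}(\eta)\,d\eta,\qquad j=1,\dots,n-1.\tag{$*$}$$ The real constant $a_0$ is free, and for each $a_0$ exactly one tuple $(a_0,\dots,a_{n-1})$ satisfies $(*)$. (iv) Suppose $(*)$ holds. Consider the problem of finding all functions $\Phi$ on $\Omega'$ that are analytic on $\Omega'$, $\mathfrak G$-automorphic and bounded at infinity, that satisfy $\overline{\Phi(T_j(\zeta))}=\Phi(\zeta)$ for $\zeta\in T_j(\mathfrak D^e)$, $j=0,\dots,n-1$, and that have at every $\xi\in\mathfrak L_j$, $j=0,\dots,n-1$, boundary values $\Phi^+(\xi)$ from the interior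 and $\Phi^-(\xi)$ from the exterior of $\mathfrak L_j$ with $$\Phi^+(\xi)-\Phi^-(\xi)=2i[\operatorname{Im}(c\xi)-a_j].$$ For every real $C_1$ the function $\Phi_1$ solves this problem, and every solution equals $\Phi_1$ on $\Omega'$ for some real $C_1$. -/

import Mathlib

open scoped ComplexConjugate OnePoint Topology

noncomputable section

/-- The Riemann sphere, as the one-point compactification of the complex plane. -/
abbrev RSphere : Type := OnePoint ℂ

/-- The finite part of a point of the sphere; it is used only at points different from `∞`. -/
def finPart (p : RSphere) : ℂ := p.elim 0 id

/-- The fraction `1 / (w - p)` for finite `w` and `p` on the sphere, with `1 / (w - ∞) = 0`. -/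
def cauchyFrac (w : ℂ) (p : RSphere) : ℂ := p.elim 0 (fun z => 1 / (w - z))

/-- The local coordinate at infinity: `w ↦ 1 / w`, with `0 ↦ ∞`. -/
def coordInfty (w : ℂ) : RSphere := if w = 0 then ∞ else ((w⁻¹ : ℂ) : RSphere)

/-- `Φ` is analytic at every point of the subset `U` of the sphere
(at `∞` in the coordinate `1 / ζ`). -/
def SphereAnalyticOn (Φ : RSphere → ℂ) (U : Set RSphere) : Prop :=
  (∀ z : ℂ, (z : RSphere) ∈ U → AnalyticAt ℂ (fun w : ℂ => Φ (w : RSphere)) z) ∧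
  (∞ ∈ U → AnalyticAt ℂ (fun w : ℂ => Φ (coordInfty w)) 0)

/-- The reflection `ζ ↦ z₀ + r² / (conj ζ - conj z₀)` of the sphere in the circle with centre `z₀`
and radius `r`; it interchanges `z₀` and `∞`. -/
def circleReflection (z₀ : ℂ) (r : ℝ) (p : RSphere) : RSphere :=
  p.elim (z₀ : RSphere)
    (fun z => if z = z₀ then ∞ else ((z₀ + (r : ℂ) ^ 2 / (conj z - conj z₀) : ℂ) : RSphere))

theorem circleReflection_involutive (z₀ : ℂ) {r : ℝ} (hr : 0 < r) :
    Function.Involutive (circleReflection z₀ r) := by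
  intro p
  have hr' : (r : ℂ) ≠ 0 := by exact_mod_cast hr.ne'
  induction p using OnePoint.rec with
  | infty => simp [circleReflection]
  | coe z =>
    by_cases hz : z = z₀
    · simp [circleReflection, hz]
    · have h1 : conj z - conj z₀ ≠ 0 := by
        rw [← map_sub]
        exact (map_ne_zero _).2 (sub_ne_zero.2 hz)
      have h2 : z - z₀ ≠ 0 := sub_ne_zero.2 hz
      have h3 : z₀ + (r : ℂ) ^ 2 / (conj z - conj z₀) ≠ z₀ := by
        intro h
        have : (r : ℂ) ^ 2 / (conj z - conj z₀) = 0 := by simpa using h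
        exact (div_ne_zero (pow_ne_zero 2 hr') h1) this
      simp only [circleReflection, OnePoint.elim_some, if_neg hz, if_neg h3]
      congr 1
      simp only [map_add, map_div₀, map_sub, map_pow, Complex.conj_conj, Complex.conj_ofReal]
      field_simp
      ring

/-- A system of `n` circles in the plane, lying outside each other. -/
structure CircleSystem (n : ℕ) where
  center : Fin n → ℂ
  radius : Fin n → ℝ
  radius_pos : ∀ j, 0 < radius j
  disjoint : Pairwise fun i j =>
    Disjoint (Metric.closedBall (center i) (radius i)) (Metric.closedBall (center j) (radius j))

namespace CircleSystem

variable {n : ℕ} (S : CircleSystem n)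

/-- The circle `𝔏_j`. -/
def circle (j : Fin n) : Set ℂ := Metric.sphere (S.center j) (S.radius j)

/-- The domain `𝔇ᵉ` exterior to all the circles; it contains `∞`. -/
def exterior : Set RSphere :=
  {∞} ∪ (fun z : ℂ => (z : RSphere)) '' {z | ∀ j, S.radius j < dist z (S.center j)}

/-- The reflection `T_j` in the circle `𝔏_j`. -/
def T (j : Fin n) : Equiv.Perm RSphere :=
  (circleReflection_involutive (S.center j) (S.radius_pos j)).toPerm _

variable [NeZero n]

/-- The transformation `σ_j = T_j T_0`. -/
def sigma (j : Fin n) : Equiv.Perm RSphere := S.T j * S.T 0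

/-- The symmetry Schottky group `𝔊`, generated by all the `σ_j`. -/
def schottky : Subgroup (Equiv.Perm RSphere) := Subgroup.closure (Set.range S.sigma)

/-- `𝔊` is of the first class: when each `σ ∈ 𝔊` is written as
`σ(ζ) = (α ζ + β) / (γ ζ + δ)`, the series of `|α δ - β γ| / |γ|²` over `σ ≠ id` converges.
(The summands do not depend on the choice of the matrices.) -/
def FirstClass : Prop :=
  ∃ M : S.schottky → GL (Fin 2) ℂ,
    (∀ (σ : S.schottky) (p : RSphere), (σ : Equiv.Perm RSphere) p = M σ • p) ∧
    Summable fun σ : {σ : S.schottky // σ ≠ 1} =>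
      ‖(M σ.1 : Matrix (Fin 2) (Fin 2) ℂ).det‖ /
        ‖(M σ.1 : Matrix (Fin 2) (Fin 2) ℂ) 1 0‖ ^ 2

/-- The union of the images `σ(𝔇ᵉ ∪ T_0(𝔇ᵉ))`, `σ ∈ 𝔊`: the region of discontinuity of `𝔊`
without the circles `σ(𝔏_j)`. Piecewise analytic functions are functions on this set. -/
def pieces : Set RSphere :=
  ⋃ σ ∈ S.schottky, σ '' (S.exterior ∪ S.T 0 '' S.exterior)

/-- The summand `(1 / (σ(η) - ζ) - 1 / (σ(η) - ζ_*)) σ'(η)` of the kernel. -/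
def kernelTerm (ζs ζ : RSphere) (η : ℂ) (σ : S.schottky) : ℂ :=
  (cauchyFrac (finPart ((σ : Equiv.Perm RSphere) η)) ζ -
      cauchyFrac (finPart ((σ : Equiv.Perm RSphere) η)) ζs) *
    deriv (fun z : ℂ => finPart ((σ : Equiv.Perm RSphere) z)) η

/-- The quasiautomorphic analogue `𝒦(ζ, η)` of the Cauchy kernel, with base point `ζ_*`. -/
def kernel (ζs ζ : RSphere) (η : ℂ) : ℂ := ∑' σ : S.schottky, S.kernelTerm ζs ζ η σ

/-- `χ_σ(η) = 𝒦(σ(ζ_*), η)`. -/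
def chi (ζs : RSphere) (σ : Equiv.Perm RSphere) (η : ℂ) : ℂ := S.kernel ζs (σ ζs) η

/-- `Ψ₁(ζ) = (2π)⁻¹ ∑_j ∫_{𝔏_j} [Im(c η) - a_j] 𝒦(ζ, η) dη`, circles counterclockwise. -/
def Psi1 (ζs : RSphere) (c : ℂ) (a : Fin n → ℝ) (ζ : RSphere) : ℂ :=
  1 / (2 * (Real.pi : ℂ)) *
    ∑ j, ∮ η in C(S.center j, S.radius j), (((c * η).im - a j : ℝ) : ℂ) * S.kernel ζs ζ η

/-- `Φ₁(ζ) = Ψ₁(ζ) + conj Ψ₁(T_0(ζ)) + C₁`. -/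
def Phi1 (ζs : RSphere) (c : ℂ) (a : Fin n → ℝ) (C₁ : ℝ) (ζ : RSphere) : ℂ :=
  S.Psi1 ζs c a ζ + conj (S.Psi1 ζs c a (S.T 0 ζ)) + (C₁ : ℂ)

/-- `Φ` is invariant under `𝔊`. -/
def IsAutomorphic (Φ : RSphere → ℂ) : Prop :=
  ∀ σ ∈ S.schottky, ∀ ζ ∈ S.pieces, Φ (σ ζ) = Φ ζ

/-- The formulas for the constants:
`a_j = a_0 + (2π)⁻¹ Im ∑_l ∫_{𝔏_l} Im(c η) χ_{σ_j}(η) dη` for `j ≠ 0`. -/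
def ConstantsFormula (ζs : RSphere) (c : ℂ) (a : Fin n → ℝ) : Prop :=
  ∀ j : Fin n, j ≠ 0 →
    a j = a 0 + 1 / (2 * Real.pi) *
      (∑ l, ∮ η in C(S.center l, S.radius l),
        (((c * η).im : ℝ) : ℂ) * S.chi ζs (S.sigma j) η).im

/-- The first Riemann–Hilbert problem: `Φ` is piecewise analytic, `𝔊`-automorphic, bounded at
infinity, symmetric with respect to every circle, and on each circle it has boundary values from
the interior and from the exterior whose difference is `2i [Im(c ξ) - a_j]`. -/
structure IsRHSolution (c : ℂ) (a : Fin n → ℝ) (Φ : RSphere → ℂ) : Prop where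
  analytic : SphereAnalyticOn Φ S.pieces
  automorphic : S.IsAutomorphic Φ
  bounded : ∃ B R : ℝ, ∀ z : ℂ, R < ‖z‖ → ‖Φ (z : RSphere)‖ ≤ B
  symmetric : ∀ j, ∀ ζ ∈ S.T j '' S.exterior, conj (Φ (S.T j ζ)) = Φ ζ
  jump : ∀ j, ∀ ξ ∈ S.circle j, ∃ Φplus Φminus : ℂ,
    Filter.Tendsto (fun z : ℂ => Φ (z : RSphere))
      (𝓝[Metric.ball (S.center j) (S.radius j)] ξ) (𝓝 Φplus) ∧
    Filter.Tendsto (fun z : ℂ => Φ (z : RSphere))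
      (𝓝[(Metric.closedBall (S.center j) (S.radius j))ᶜ] ξ) (𝓝 Φminus) ∧
    Φplus - Φminus = 2 * Complex.I * (((c * ξ).im - a j : ℝ) : ℂ)

end CircleSystem

end

/-! The argument rests on one identity and one picture. The identity is `cauchyFrac_smul`: for a
Möbius map σ, the quotient σ'(η)/(σ(η)-σ(p)) is 1/(η-p) minus a term free of p. Each summand of the
kernel is a difference of two such quotients, so 𝒦(ζ,η) = Σ_σ [1/(η-σ(ζ)) - 1/(η-σ(ζ_*))], and
moving ζ by an element of the group only permutes the ζ-terms; this is the quasiautomorphy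
(`kernel_apply`).

The picture is ping-pong (`wordProd_mem_disc`): a reduced word of reflections sends whatever lies
outside the closed disc of its last letter into the disc of its first letter. Hence the poles
σ⁻¹(∞), σ ≠ 1, keep a uniform distance from the circles (`exists_pos_forall_le_dist`), and the
first-class series dominates |σ'| there. Hence also σ(ζ_*) and σ(σ_j(ζ_*)) share a disc unless σ is
1 or σ_j⁻¹, so only two terms of ∮χ survive (`circleIntegral_chi`).

Because T_0 σ_j = σ_j⁻¹ T_0, the constant that Ψ₁ gains under σ_j enters Φ₁ minus its conjugate: Φ₁
gains 2i Im Ψ₁(σ_j(ζ_*)). The integrals of χ turn the vanishing of this number into the formula for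
a_j - a_0. Near a circle only the term σ = 1 of Ψ₁ jumps; there the density is a Laurent polynomial,
so its Cauchy transform and the jump are explicit, and the reflected summand of Φ₁ doubles the jump.

For uniqueness, symmetry makes the inner boundary value the conjugate of the outer one, so the jump
prescribes the imaginary part of the outer value. The difference F of two solutions has real
boundary values on the exterior. The maximum principle for exp(±iF) and the open mapping theorem
make it a real constant (`exists_eq_const_of_im_boundary_eq_zero`), which automorphy and symmetry
carry to all pieces. -/

noncomputable section

/-! ### Möbius transformations of the sphere and the Cauchy fraction. -/

section Sphere

open Set Filter Metric

theorem continuous_coordInfty : Continuous coordInfty := by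
  rw [continuous_iff_continuousAt]
  intro w
  by_cases hw : w = 0
  · subst hw
    have h0 : coordInfty 0 = ∞ := by simp [coordInfty]
    rw [continuousAt_iff_punctured_nhds, h0]
    have h1 : Tendsto (fun w : ℂ => ((w⁻¹ : ℂ) : RSphere)) (𝓝[≠] 0) (𝓝 ∞) := by
      refine OnePoint.tendsto_coe_infty.comp ?_
      rw [coclosedCompact_eq_cocompact, ← Metric.cobounded_eq_cocompact]
      exact tendsto_inv₀_nhdsNE_zero
    refine h1.congr' ?_
    filter_upwards [self_mem_nhdsWithin] with z hz
    simp [coordInfty, show z ≠ 0 from hz]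
  · have h1 : ContinuousAt (fun w : ℂ => ((w⁻¹ : ℂ) : RSphere)) w :=
      OnePoint.continuous_coe.continuousAt.comp (continuousAt_inv₀ hw)
    refine h1.congr ?_
    filter_upwards [isOpen_ne.mem_nhds hw] with z hz
    simp [coordInfty, show z ≠ 0 from hz]

theorem det_smul_ne_zero (N : GL (Fin 2) ℂ) : N 0 0 * N 1 1 - N 0 1 * N 1 0 ≠ 0 := by
  have := N.det_ne_zero
  rwa [Matrix.det_fin_two] at this

theorem smul_coe_of_ne {N : GL (Fin 2) ℂ} {w : ℂ} (h : N 1 0 * w + N 1 1 ≠ 0) :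
    N • (w : RSphere) = (((N 0 0 * w + N 0 1) / (N 1 0 * w + N 1 1) : ℂ) : RSphere) := by
  rw [OnePoint.smul_some_eq_ite, if_neg h]

theorem smul_coe_of_eq {N : GL (Fin 2) ℂ} {w : ℂ} (h : N 1 0 * w + N 1 1 = 0) :
    N • (w : RSphere) = ∞ := by
  rw [OnePoint.smul_some_eq_ite, if_pos h]

theorem smul_coe_ne_infty_iff {N : GL (Fin 2) ℂ} {w : ℂ} :
    N • (w : RSphere) ≠ ∞ ↔ N 1 0 * w + N 1 1 ≠ 0 := by
  rw [OnePoint.smul_some_eq_ite]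
  split_ifs with h <;> simp [h]

theorem num_ne_zero_of_den_eq_zero {N : GL (Fin 2) ℂ} {w : ℂ} (h : N 1 0 * w + N 1 1 = 0) :
    N 0 0 * w + N 0 1 ≠ 0 := by
  intro h'
  refine det_smul_ne_zero N ?_
  by_cases hc : N 1 0 = 0
  · have hd : N 1 1 = 0 := by simpa [hc] using h
    simp [hc, hd]
  · have : N 1 0 * (N 0 0 * N 1 1 - N 0 1 * N 1 0) = 0 := by
      linear_combination (N 0 0 * N 1 0) * h - N 1 0 ^ 2 * h'
    exact (mul_eq_zero.1 this).resolve_left hc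

/-- Covers a neighbourhood of the pole of `N`, since numerator and denominator never vanish
together. -/
theorem smul_coe_eq_coordInfty {N : GL (Fin 2) ℂ} {w : ℂ} (h : N 0 0 * w + N 0 1 ≠ 0) :
    N • (w : RSphere) = coordInfty ((N 1 0 * w + N 1 1) / (N 0 0 * w + N 0 1)) := by
  rw [OnePoint.smul_some_eq_ite, coordInfty]
  by_cases h1 : N 1 0 * w + N 1 1 = 0
  · simp [h1]
  · rw [if_neg h1, if_neg (div_ne_zero h1 h), inv_div]

theorem eventually_affine_ne_zero {a b w : ℂ} (h : a * w + b ≠ 0) :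
    ∀ᶠ z in 𝓝 w, a * z + b ≠ 0 := by
  have : ContinuousAt (fun z : ℂ => a * z + b) w := by fun_prop
  exact this.eventually_ne h

theorem continuous_smul_coe (N : GL (Fin 2) ℂ) : Continuous fun w : ℂ => N • (w : RSphere) := by
  rw [continuous_iff_continuousAt]
  intro w
  by_cases h : N 1 0 * w + N 1 1 = 0
  · have h' := num_ne_zero_of_den_eq_zero h
    have h1 : ContinuousAt
        (fun w : ℂ => coordInfty ((N 1 0 * w + N 1 1) / (N 0 0 * w + N 0 1))) w :=
      continuous_coordInfty.continuousAt.comp (by fun_prop (disch := assumption))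
    refine h1.congr ?_
    filter_upwards [eventually_affine_ne_zero h'] with z hz
    rw [smul_coe_eq_coordInfty hz]
  · have h1 : ContinuousAt
        (fun w : ℂ => (((N 0 0 * w + N 0 1) / (N 1 0 * w + N 1 1) : ℂ) : RSphere)) w :=
      OnePoint.continuous_coe.continuousAt.comp
        (f := fun w : ℂ => (N 0 0 * w + N 0 1) / (N 1 0 * w + N 1 1))
        (by fun_prop (disch := assumption))
    refine h1.congr ?_
    filter_upwards [eventually_affine_ne_zero h] with z hz
    rw [smul_coe_of_ne hz]

/-- A function analytic on a subset of the sphere is analytic in every Möbius coordinate. -/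
theorem SphereAnalyticOn.analyticAt_smul {Φ : RSphere → ℂ} {U : Set RSphere}
    (hΦ : SphereAnalyticOn Φ U) (N : GL (Fin 2) ℂ) {w : ℂ} (hw : N • (w : RSphere) ∈ U) :
    AnalyticAt ℂ (fun z : ℂ => Φ (N • (z : RSphere))) w := by
  by_cases h : N 1 0 * w + N 1 1 = 0
  · have h' := num_ne_zero_of_den_eq_zero h
    rw [smul_coe_of_eq h] at hw
    have h1 : AnalyticAt ℂ (fun w : ℂ => (N 1 0 * w + N 1 1) / (N 0 0 * w + N 0 1)) w := by
      fun_prop (disch := assumption)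
    have h2 := (hΦ.2 hw).comp_of_eq h1 (by simp [h])
    refine h2.congr ?_
    filter_upwards [eventually_affine_ne_zero h'] with z hz
    simp [smul_coe_eq_coordInfty hz]
  · rw [smul_coe_of_ne h] at hw
    have h1 : AnalyticAt ℂ (fun w : ℂ => (N 0 0 * w + N 0 1) / (N 1 0 * w + N 1 1)) w := by
      fun_prop (disch := assumption)
    have h2 := (hΦ.1 _ hw).comp_of_eq h1 rfl
    refine h2.congr ?_
    filter_upwards [eventually_affine_ne_zero h] with z hz
    simp [smul_coe_of_ne hz]

/-- The Möbius transformation `w ↦ 1 / w`. -/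
def inversionGL : GL (Fin 2) ℂ :=
  Matrix.GeneralLinearGroup.mkOfDetNeZero !![0, 1; 1, 0] (by simp [Matrix.det_fin_two])

theorem inversionGL_smul (w : ℂ) : inversionGL • (w : RSphere) = coordInfty w := by
  have := smul_coe_eq_coordInfty (N := inversionGL) (w := w)
    (by simp [inversionGL, Matrix.GeneralLinearGroup.mkOfDetNeZero])
  rw [this]
  simp [inversionGL, Matrix.GeneralLinearGroup.mkOfDetNeZero]

theorem cauchyFrac_coe (w z : ℂ) : cauchyFrac w (z : RSphere) = 1 / (w - z) := rfl

theorem cauchyFrac_infty (w : ℂ) : cauchyFrac w ∞ = 0 := rfl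

/-- The second factor is the derivative of `N` at `w`. What matters is that the correction term on
the right does not depend on `p`, so it cancels in every summand of the kernel. -/
theorem cauchyFrac_smul (N : GL (Fin 2) ℂ) {w : ℂ} {p : RSphere}
    (hw : N 1 0 * w + N 1 1 ≠ 0) (hp : p ≠ (w : RSphere)) :
    cauchyFrac ((N 0 0 * w + N 0 1) / (N 1 0 * w + N 1 1)) (N • p) *
        ((N 0 0 * N 1 1 - N 0 1 * N 1 0) / (N 1 0 * w + N 1 1) ^ 2) =
      cauchyFrac w p - N 1 0 / (N 1 0 * w + N 1 1) := by
  have hdet := det_smul_ne_zero N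
  induction p using OnePoint.rec with
  | infty =>
    rw [OnePoint.smul_infty_eq_ite]
    by_cases hc : N 1 0 = 0
    · simp [hc, cauchyFrac_infty]
    · rw [if_neg hc, cauchyFrac_coe, cauchyFrac_infty]
      have h1 : (N 0 0 * w + N 0 1) / (N 1 0 * w + N 1 1) - N 0 0 / N 1 0 =
          -(N 0 0 * N 1 1 - N 0 1 * N 1 0) / ((N 1 0 * w + N 1 1) * N 1 0) := by
        rw [div_sub_div _ _ hw hc]
        congr 1
        ring
      rw [h1]
      field_simp
      ring
  | coe z =>
    have hz : w - z ≠ 0 := fun h => hp (by rw [sub_eq_zero.1 h])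
    by_cases h : N 1 0 * z + N 1 1 = 0
    · rw [smul_coe_of_eq h, cauchyFrac_coe, cauchyFrac_infty]
      have : N 1 0 * w + N 1 1 = N 1 0 * (w - z) := by linear_combination h
      have hc : N 1 0 ≠ 0 := by
        intro hc
        rw [this, hc] at hw
        simp at hw
      rw [this]
      field_simp
      ring
    · rw [smul_coe_of_ne h, cauchyFrac_coe, cauchyFrac_coe]
      have h1 : (N 0 0 * w + N 0 1) / (N 1 0 * w + N 1 1) -
          (N 0 0 * z + N 0 1) / (N 1 0 * z + N 1 1) =
          (N 0 0 * N 1 1 - N 0 1 * N 1 0) * (w - z) /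
            ((N 1 0 * w + N 1 1) * (N 1 0 * z + N 1 1)) := by
        rw [div_sub_div _ _ hw h]
        congr 1
        ring
      rw [h1]
      field_simp
      ring

theorem hasDerivAt_finPart_smul (N : GL (Fin 2) ℂ) {w : ℂ} (hw : N 1 0 * w + N 1 1 ≠ 0) :
    HasDerivAt (fun z : ℂ => finPart (N • (z : RSphere)))
      ((N 0 0 * N 1 1 - N 0 1 * N 1 0) / (N 1 0 * w + N 1 1) ^ 2) w := by
  have h1 : HasDerivAt (fun z : ℂ => N 0 0 * z + N 0 1) (N 0 0) w := by
    simpa using ((hasDerivAt_id w).const_mul (N 0 0)).add_const (N 0 1)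
  have h2 : HasDerivAt (fun z : ℂ => N 1 0 * z + N 1 1) (N 1 0) w := by
    simpa using ((hasDerivAt_id w).const_mul (N 1 0)).add_const (N 1 1)
  refine ((h1.div h2 hw).congr_deriv ?_).congr_of_eventuallyEq ?_
  · ring
  · filter_upwards [eventually_affine_ne_zero hw] with z hz
    rw [smul_coe_of_ne hz]
    rfl

theorem differentiableAt_cauchyFrac_smul (N : GL (Fin 2) ℂ) {v w : ℂ}
    (h : N • (w : RSphere) ≠ (v : RSphere)) :
    DifferentiableAt ℂ (fun z : ℂ => cauchyFrac v (N • (z : RSphere))) w := by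
  -- Clearing the inner denominator gives a quotient that remains regular at the pole of `N`, where
  -- the fraction has the value 0.
  have key : v * (N 1 0 * w + N 1 1) - (N 0 0 * w + N 0 1) ≠ 0 := by
    intro h0
    by_cases hw : N 1 0 * w + N 1 1 = 0
    · exact num_ne_zero_of_den_eq_zero hw (by linear_combination v * hw - h0)
    · apply h
      rw [smul_coe_of_ne hw]
      congr 1
      rw [div_eq_iff hw]
      linear_combination -h0
  have h1 : DifferentiableAt ℂ (fun z : ℂ => (N 1 0 * z + N 1 1) /
      (v * (N 1 0 * z + N 1 1) - (N 0 0 * z + N 0 1))) w := by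
    fun_prop (disch := assumption)
  refine h1.congr_of_eventuallyEq ?_
  have h2 : ContinuousAt (fun z : ℂ => v * (N 1 0 * z + N 1 1) - (N 0 0 * z + N 0 1)) w := by
    fun_prop
  filter_upwards [h2.eventually_ne key] with z hz
  by_cases hw : N 1 0 * z + N 1 1 = 0
  · rw [smul_coe_of_eq hw, hw]
    simp [cauchyFrac_infty]
  · rw [smul_coe_of_ne hw, cauchyFrac_coe]
    have : v - (N 0 0 * z + N 0 1) / (N 1 0 * z + N 1 1) =
        (v * (N 1 0 * z + N 1 1) - (N 0 0 * z + N 0 1)) / (N 1 0 * z + N 1 1) := by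
      rw [sub_div, mul_div_cancel_right₀ _ hw]
    rw [this, one_div_div]

theorem finPart_coe (z : ℂ) : finPart (z : RSphere) = z := rfl

theorem coe_finPart {p : RSphere} (hp : p ≠ ∞) : ((finPart p : ℂ) : RSphere) = p := by
  induction p using OnePoint.rec with
  | infty => exact absurd rfl hp
  | coe z => rfl

end Sphere

/-! ### Reflections as Möbius maps composed with conjugation. -/

section Reflection

open Set Filter Metric

/-- The matrix of the Möbius transformation `w ↦ T (conj w)`, where `T` is the reflection in the
circle with centre `z₀` and radius `r`. -/
def reflectionGL (z₀ : ℂ) {r : ℝ} (hr : 0 < r) : GL (Fin 2) ℂ :=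
  Matrix.GeneralLinearGroup.mkOfDetNeZero !![z₀, (r : ℂ) ^ 2 - z₀ * conj z₀; 1, -conj z₀] (by
    have hr' : (r : ℂ) ≠ 0 := by exact_mod_cast hr.ne'
    have : z₀ * -conj z₀ - ((r : ℂ) ^ 2 - z₀ * conj z₀) * 1 = -(r : ℂ) ^ 2 := by ring
    rw [Matrix.det_fin_two_of, this]
    exact neg_ne_zero.2 (pow_ne_zero 2 hr'))

theorem coe_reflectionGL (z₀ : ℂ) {r : ℝ} (hr : 0 < r) :
    (reflectionGL z₀ hr : Matrix (Fin 2) (Fin 2) ℂ) =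
      !![z₀, (r : ℂ) ^ 2 - z₀ * conj z₀; 1, -conj z₀] := rfl

theorem circleReflection_coe (z₀ : ℂ) {r : ℝ} (hr : 0 < r) (w : ℂ) :
    circleReflection z₀ r (w : RSphere) = reflectionGL z₀ hr • ((conj w : ℂ) : RSphere) := by
  rw [OnePoint.smul_some_eq_ite, coe_reflectionGL]
  simp only [circleReflection, OnePoint.elim_some]
  by_cases hw : w = z₀
  · simp [hw]
  · have h1 : conj w - conj z₀ ≠ 0 := by
      rw [← map_sub]
      exact (map_ne_zero _).2 (sub_ne_zero.2 hw)
    have h2 : ¬ 1 * conj w + -conj z₀ = 0 := by rwa [one_mul, ← sub_eq_add_neg]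
    simp only [hw, if_false, Matrix.of_apply, Matrix.cons_val', Matrix.cons_val_zero,
      Matrix.cons_val_one, Matrix.cons_val_fin_one, h2]
    refine OnePoint.coe_eq_coe.2 ?_
    rw [one_mul, ← sub_eq_add_neg]
    field_simp
    ring

theorem circleReflection_coordInfty (z₀ : ℂ) {r : ℝ} (hr : 0 < r) (w : ℂ) :
    circleReflection z₀ r (coordInfty w) =
      (reflectionGL z₀ hr * inversionGL) • ((conj w : ℂ) : RSphere) := by
  rw [mul_smul, inversionGL_smul]
  by_cases hw : w = 0
  · subst hw
    have h0 : coordInfty 0 = ∞ := by simp [coordInfty]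
    rw [map_zero, h0, OnePoint.smul_infty_eq_ite]
    simp [reflectionGL, Matrix.GeneralLinearGroup.mkOfDetNeZero, circleReflection]
  · have h1 : conj w ≠ 0 := (map_ne_zero _).2 hw
    rw [coordInfty, if_neg hw, coordInfty, if_neg h1, circleReflection_coe z₀ hr, map_inv₀]

theorem continuous_circleReflection (z₀ : ℂ) {r : ℝ} (hr : 0 < r) :
    Continuous (circleReflection z₀ r) := by
  rw [continuous_iff_continuousAt]
  intro p
  induction p using OnePoint.rec with
  | infty =>
    rw [OnePoint.continuousAt_infty', coclosedCompact_eq_cocompact,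
      ← Metric.cobounded_eq_cocompact]
    have h1 : Tendsto (fun z : ℂ => z₀ + (r : ℂ) ^ 2 * (conj (z - z₀))⁻¹) (Bornology.cobounded ℂ)
        (𝓝 (z₀ + (r : ℂ) ^ 2 * 0)) := by
      refine (Tendsto.const_mul _ ?_).const_add _
      refine tendsto_inv₀_cobounded.comp ?_
      rw [← tendsto_norm_atTop_iff_cobounded]
      simp only [RCLike.norm_conj]
      rw [tendsto_norm_atTop_iff_cobounded]
      simp [sub_eq_add_neg]
    have h2 : ((z₀ + (r : ℂ) ^ 2 * 0 : ℂ) : RSphere) = circleReflection z₀ r ∞ := by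
      simp [circleReflection]
    rw [← h2]
    refine ((OnePoint.continuous_coe.tendsto _).comp h1).congr' ?_
    have h3 : ∀ᶠ z : ℂ in Bornology.cobounded ℂ, z ≠ z₀ := by
      have : Bornology.IsBounded {z₀} := Bornology.isBounded_singleton (x := z₀)
      filter_upwards [Bornology.isBounded_def.1 this] with z hz using hz
    filter_upwards [h3] with z hz
    simp [circleReflection, hz, div_eq_mul_inv]
  | coe z =>
    rw [OnePoint.continuousAt_coe]
    have h1 : (circleReflection z₀ r ∘ fun w : ℂ => (w : RSphere)) =
        fun w : ℂ => reflectionGL z₀ hr • ((conj w : ℂ) : RSphere) :=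
      funext fun w => circleReflection_coe z₀ hr w
    rw [h1]
    exact ((continuous_smul_coe _).comp Complex.continuous_conj).continuousAt

end Reflection

/-! ### Explicit Cauchy transforms on one circle. -/

section CircleIntegrals

open Set Filter Metric

theorem circleIntegral_cauchyFrac_of_mem {z₀ z : ℂ} {r : ℝ} (hz : z ∈ ball z₀ r) :
    (∮ η in C(z₀, r), cauchyFrac η (z : RSphere)) = 2 * Real.pi * Complex.I := by
  simp only [cauchyFrac_coe, one_div]
  exact circleIntegral.integral_sub_inv_of_mem_ball hz

theorem coe_mem_image_coe {s : Set ℂ} {z : ℂ} :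
    (z : RSphere) ∈ (fun z : ℂ => (z : RSphere)) '' s ↔ z ∈ s :=
  OnePoint.coe_injective.mem_set_image

theorem infty_notMem_image_coe {s : Set ℂ} :
    (∞ : RSphere) ∉ (fun z : ℂ => (z : RSphere)) '' s := by
  rintro ⟨z, -, hz⟩
  exact OnePoint.coe_ne_infty z hz

theorem circleIntegral_mul_cauchyFrac_eq_zero {z₀ : ℂ} {r : ℝ} (hr : 0 ≤ r) {p : RSphere}
    (hp : p ∉ (fun z : ℂ => (z : RSphere)) '' closedBall z₀ r) {f : ℂ → ℂ}
    (hf : Differentiable ℂ f) :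
    (∮ η in C(z₀, r), f η * cauchyFrac η p) = 0 := by
  induction p using OnePoint.rec with
  | infty => simp [cauchyFrac_infty, circleIntegral]
  | coe z =>
    rw [coe_mem_image_coe] at hp
    have hd : ∀ w ∈ closedBall z₀ r, DifferentiableAt ℂ
        (fun η => f η * cauchyFrac η (z : RSphere)) w := by
      intro w hw
      have : w - z ≠ 0 := fun h => hp (by rwa [← sub_eq_zero.1 h])
      simp only [cauchyFrac_coe]
      exact hf.differentiableAt.mul (by fun_prop (disch := assumption))
    exact Complex.circleIntegral_eq_zero_of_differentiable_on_off_countable hr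
      countable_empty (fun w hw => (hd w hw).continuousAt.continuousWithinAt)
      (fun w hw => hd w (ball_subset_closedBall hw.1))

theorem circleIntegral_cauchyFrac_of_notMem {z₀ : ℂ} {r : ℝ} (hr : 0 ≤ r) {p : RSphere}
    (hp : p ∉ (fun z : ℂ => (z : RSphere)) '' closedBall z₀ r) :
    (∮ η in C(z₀, r), cauchyFrac η p) = 0 := by
  simpa using circleIntegral_mul_cauchyFrac_eq_zero hr hp (differentiable_const (1 : ℂ))

theorem circleIntegral_mul_cauchyFrac_of_mem {z₀ z : ℂ} {r : ℝ} (hz : z ∈ ball z₀ r) {f : ℂ → ℂ}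
    (hf : Differentiable ℂ f) :
    (∮ η in C(z₀, r), f η * cauchyFrac η (z : RSphere)) = 2 * Real.pi * Complex.I * f z := by
  have := Complex.circleIntegral_sub_inv_smul_of_differentiable_on_off_countable
    countable_empty hz hf.continuous.continuousOn (fun w _ => hf w)
  simp only [smul_eq_mul] at this
  rw [← this]
  congr 1
  ext η
  rw [cauchyFrac_coe, one_div, mul_comm]

theorem circleIntegrable_cauchyFrac {z₀ : ℂ} {r : ℝ} (hr : 0 ≤ r) {p : RSphere}
    (hp : p ∉ (fun z : ℂ => (z : RSphere)) '' sphere z₀ r) {f : ℂ → ℂ}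
    (hf : ContinuousOn f (sphere z₀ r)) :
    CircleIntegrable (fun η => f η * cauchyFrac η p) z₀ r := by
  refine ContinuousOn.circleIntegrable hr (hf.mul ?_)
  induction p using OnePoint.rec with
  | infty =>
    simp only [cauchyFrac_infty]
    exact continuousOn_const
  | coe z =>
    rw [coe_mem_image_coe] at hp
    simp only [cauchyFrac_coe]
    intro w hw
    have : w - z ≠ 0 := fun h => hp (by rwa [← sub_eq_zero.1 h])
    exact ContinuousAt.continuousWithinAt (by fun_prop (disch := assumption))

/-- Partial fractions: the integral of a product of two simple poles reduces to two winding numbers.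
-/
theorem inv_sub_mul_cauchyFrac {z₀ z η : ℂ} (h : z ≠ z₀) (h1 : η ≠ z) (h2 : η ≠ z₀) :
    (η - z₀)⁻¹ * cauchyFrac η (z : RSphere) =
      cauchyFrac z₀ (z : RSphere) *
        (cauchyFrac η (z₀ : RSphere) - cauchyFrac η (z : RSphere)) := by
  simp only [cauchyFrac_coe]
  have a1 := sub_ne_zero.2 h.symm
  have a2 := sub_ne_zero.2 h1
  have a3 := sub_ne_zero.2 h2
  field_simp
  ring

theorem circleIntegral_inv_sub_mul_cauchyFrac {z₀ z : ℂ} {r : ℝ} (hr : 0 < r) (h : z ≠ z₀)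
    (hz : z ∉ sphere z₀ r) :
    (∮ η in C(z₀, r), (η - z₀)⁻¹ * cauchyFrac η (z : RSphere)) =
      cauchyFrac z₀ (z : RSphere) * (2 * Real.pi * Complex.I -
        ∮ η in C(z₀, r), cauchyFrac η (z : RSphere)) := by
  have h1 : EqOn (fun η => (η - z₀)⁻¹ * cauchyFrac η (z : RSphere))
      (fun η => cauchyFrac z₀ (z : RSphere) *
        (cauchyFrac η (z₀ : RSphere) - cauchyFrac η (z : RSphere))) (sphere z₀ r) := by
    intro η hη
    refine inv_sub_mul_cauchyFrac h (fun e => hz (e ▸ hη)) ?_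
    rintro rfl
    simp [hr.ne] at hη
  have hz0 : (z₀ : RSphere) ∉ (fun z : ℂ => (z : RSphere)) '' sphere z₀ r := by
    rw [coe_mem_image_coe]
    simp [hr.ne]
  rw [circleIntegral.integral_congr hr.le h1, circleIntegral.integral_const_mul,
    circleIntegral.integral_sub, circleIntegral_cauchyFrac_of_mem (mem_ball_self hr)]
  · simpa using circleIntegrable_cauchyFrac hr.le hz0 (continuousOn_const (c := (1 : ℂ)))
  · simpa using circleIntegrable_cauchyFrac hr.le (p := (z : RSphere))
      (by rwa [coe_mem_image_coe]) (continuousOn_const (c := (1 : ℂ)))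

theorem circleIntegral_inv_sub_mul_cauchyFrac_of_mem {z₀ z : ℂ} {r : ℝ} (hz : z ∈ ball z₀ r) :
    (∮ η in C(z₀, r), (η - z₀)⁻¹ * cauchyFrac η (z : RSphere)) = 0 := by
  have hr : 0 < r := pos_of_mem_ball hz
  by_cases h : z = z₀
  · subst h
    -- At the centre the two poles merge into a double pole without residue.
    have := circleIntegral.integral_sub_zpow_of_ne (n := -2) (by norm_num) z z r
    rw [← this]
    congr 1
    ext η
    rw [cauchyFrac_coe, one_div, ← mul_inv, zpow_neg]
    norm_cast
    rw [sq]
  · rw [circleIntegral_inv_sub_mul_cauchyFrac hr h, circleIntegral_cauchyFrac_of_mem hz]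
    · simp
    · intro h'
      rw [mem_sphere] at h'
      exact (mem_ball.1 hz).ne h'

theorem circleIntegral_inv_sub_mul_cauchyFrac_of_notMem {z₀ : ℂ} {r : ℝ} (hr : 0 < r)
    {p : RSphere} (hp : p ∉ (fun z : ℂ => (z : RSphere)) '' closedBall z₀ r) :
    (∮ η in C(z₀, r), (η - z₀)⁻¹ * cauchyFrac η p) =
      2 * Real.pi * Complex.I * cauchyFrac z₀ p := by
  have h0 := circleIntegral_cauchyFrac_of_notMem hr.le hp
  induction p using OnePoint.rec with
  | infty => simp [cauchyFrac_infty, circleIntegral]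
  | coe z =>
    rw [coe_mem_image_coe] at hp
    rw [circleIntegral_inv_sub_mul_cauchyFrac hr, h0]
    · ring
    · rintro rfl
      exact hp (mem_closedBall_self hr.le)
    · exact fun h => hp (sphere_subset_closedBall h)

/-- The Cauchy transform of the function `η ↦ Im (c η) - a` on a circle. -/
def imTransform (c : ℂ) (a : ℝ) (z₀ : ℂ) (r : ℝ) (p : RSphere) : ℂ :=
  ∮ η in C(z₀, r), (((c * η).im - a : ℝ) : ℂ) * cauchyFrac η p

/-- On the circle conj η = conj z₀ + r²/(η - z₀), so the density is an affine function plus a simple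
pole at the centre. No general jump theorem for Cauchy integrals is needed. -/
theorem im_mul_sub_eq_of_mem_sphere (c : ℂ) (a : ℝ) {z₀ η : ℂ} {r : ℝ} (hr : 0 < r)
    (hη : η ∈ sphere z₀ r) :
    (((c * η).im - a : ℝ) : ℂ) =
      (c / (2 * Complex.I) * η + (-(conj c * conj z₀) / (2 * Complex.I) - a)) +
        -(conj c * r ^ 2) / (2 * Complex.I) * (η - z₀)⁻¹ := by
  have h0 : η - z₀ ≠ 0 := by
    rw [sub_ne_zero]
    rintro rfl
    simp [hr.ne] at hη
  have h1 : conj η = conj z₀ + r ^ 2 * (η - z₀)⁻¹ := by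
    have h2 : (η - z₀) * conj (η - z₀) = (r : ℂ) ^ 2 := by
      rw [Complex.mul_conj', ← dist_eq_norm, mem_sphere.1 hη]
    rw [map_sub] at h2
    field_simp
    linear_combination h2
  have h3 : (((c * η).im : ℝ) : ℂ) = (c * η - conj (c * η)) / (2 * Complex.I) := by
    rw [Complex.im_eq_sub_conj]
  push_cast
  rw [h3, map_mul, h1]
  ring

variable {c : ℂ} {a : ℝ} {z₀ : ℂ} {r : ℝ}

theorem imTransform_split (hr : 0 < r) {p : RSphere}
    (hp : p ∉ (fun z : ℂ => (z : RSphere)) '' sphere z₀ r) :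
    imTransform c a z₀ r p =
      (∮ η in C(z₀, r), (c / (2 * Complex.I) * η +
        (-(conj c * conj z₀) / (2 * Complex.I) - a)) * cauchyFrac η p) +
      -(conj c * r ^ 2) / (2 * Complex.I) * ∮ η in C(z₀, r), (η - z₀)⁻¹ * cauchyFrac η p := by
  have h1 : EqOn (fun η => (((c * η).im - a : ℝ) : ℂ) * cauchyFrac η p)
      (fun η => (c / (2 * Complex.I) * η +
        (-(conj c * conj z₀) / (2 * Complex.I) - a)) * cauchyFrac η p +
        -(conj c * r ^ 2) / (2 * Complex.I) * ((η - z₀)⁻¹ * cauchyFrac η p)) (sphere z₀ r) := by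
    intro η hη
    simp only
    rw [im_mul_sub_eq_of_mem_sphere c a hr hη]
    ring
  rw [imTransform, circleIntegral.integral_congr hr.le h1, circleIntegral.integral_add,
    circleIntegral.integral_const_mul]
  · exact circleIntegrable_cauchyFrac hr.le hp (by fun_prop)
  · simp only [← mul_assoc]
    refine circleIntegrable_cauchyFrac hr.le hp fun w hw => ?_
    have : w - z₀ ≠ 0 := by
      rw [sub_ne_zero]
      rintro rfl
      simp [hr.ne] at hw
    exact ContinuousAt.continuousWithinAt (by fun_prop (disch := assumption))

/-- Inside the circle the polar part integrates to zero and the affine part is reproduced; outside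
the roles are exchanged. -/
theorem imTransform_of_mem {z : ℂ} (hz : z ∈ ball z₀ r) :
    imTransform c a z₀ r (z : RSphere) = 2 * Real.pi * Complex.I *
      (c / (2 * Complex.I) * z + (-(conj c * conj z₀) / (2 * Complex.I) - a)) := by
  have hr : 0 < r := pos_of_mem_ball hz
  rw [imTransform_split hr, circleIntegral_inv_sub_mul_cauchyFrac_of_mem hz,
    circleIntegral_mul_cauchyFrac_of_mem hz (by fun_prop)]
  · ring
  · rw [coe_mem_image_coe]
    exact fun h => (mem_ball.1 hz).ne (mem_sphere.1 h)

theorem imTransform_of_notMem (hr : 0 < r) {p : RSphere}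
    (hp : p ∉ (fun z : ℂ => (z : RSphere)) '' closedBall z₀ r) :
    imTransform c a z₀ r p = 2 * Real.pi * Complex.I *
      (-(conj c * r ^ 2) / (2 * Complex.I) * cauchyFrac z₀ p) := by
  rw [imTransform_split hr, circleIntegral_inv_sub_mul_cauchyFrac_of_notMem hr hp,
    circleIntegral_mul_cauchyFrac_eq_zero hr.le hp (by fun_prop)]
  · ring
  · exact fun h => hp (image_mono sphere_subset_closedBall h)

theorem isClosed_image_closedBall (z₀ : ℂ) (r : ℝ) :
    IsClosed ((fun z : ℂ => (z : RSphere)) '' closedBall z₀ r) :=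
  ((isCompact_closedBall z₀ r).image OnePoint.continuous_coe).isClosed

/-- Locally the transform is one of the two closed forms. The Möbius coordinate `N` is kept so that
`∞` and the group images need no separate treatment. -/
theorem differentiableAt_imTransform_smul (hr : 0 < r) (N : GL (Fin 2) ℂ) {w : ℂ}
    (hw : N • (w : RSphere) ∉ (fun z : ℂ => (z : RSphere)) '' sphere z₀ r) :
    DifferentiableAt ℂ (fun z : ℂ => imTransform c a z₀ r (N • (z : RSphere))) w := by
  have hN := (continuous_smul_coe N).continuousAt (x := w)
  by_cases h : N • (w : RSphere) ∈ (fun z : ℂ => (z : RSphere)) '' closedBall z₀ r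
  · have h1 : N • (w : RSphere) ∈ (fun z : ℂ => (z : RSphere)) '' ball z₀ r := by
      obtain ⟨z, hz, e⟩ := h
      rw [← e] at hw ⊢
      rw [coe_mem_image_coe] at hw ⊢
      exact lt_of_le_of_ne hz hw
    have h2 : N 1 0 * w + N 1 1 ≠ 0 := by
      rw [← smul_coe_ne_infty_iff]
      intro e
      rw [e] at h
      exact infty_notMem_image_coe h
    have h3 : DifferentiableAt ℂ (fun z : ℂ => 2 * Real.pi * Complex.I *
        (c / (2 * Complex.I) * finPart (N • (z : RSphere)) +
          (-(conj c * conj z₀) / (2 * Complex.I) - a))) w :=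
      (((hasDerivAt_finPart_smul N h2).differentiableAt.const_mul _).add_const _).const_mul _
    refine h3.congr_of_eventuallyEq ?_
    filter_upwards [hN ((OnePoint.isOpenMap_coe _ isOpen_ball).mem_nhds h1)] with z hz
    obtain ⟨v, hv, e⟩ := hz
    simp only at e
    rw [← e, imTransform_of_mem hv, finPart_coe]
  · have h1 : DifferentiableAt ℂ (fun z : ℂ => 2 * Real.pi * Complex.I *
        (-(conj c * r ^ 2) / (2 * Complex.I) * cauchyFrac z₀ (N • (z : RSphere)))) w := by
      refine ((differentiableAt_cauchyFrac_smul N ?_).const_mul _).const_mul _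
      intro e
      rw [e, coe_mem_image_coe] at h
      exact h (mem_closedBall_self hr.le)
    refine h1.congr_of_eventuallyEq ?_
    filter_upwards [hN ((isClosed_image_closedBall z₀ r).isOpen_compl.mem_nhds h)] with z hz
    rw [imTransform_of_notMem hr hz]

/-- Both closed forms are continuous at ξ, and their difference there reassembles the density. -/
theorem imTransform_jump {ξ : ℂ} (hr : 0 < r) (hξ : ξ ∈ sphere z₀ r) :
    ∃ P M : ℂ, Tendsto (fun z : ℂ => imTransform c a z₀ r (z : RSphere)) (𝓝[ball z₀ r] ξ) (𝓝 P) ∧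
      Tendsto (fun z : ℂ => imTransform c a z₀ r (z : RSphere)) (𝓝[(closedBall z₀ r)ᶜ] ξ) (𝓝 M) ∧
      P - M = 2 * Real.pi * Complex.I * (((c * ξ).im - a : ℝ) : ℂ) := by
  have hne : z₀ - ξ ≠ 0 := by
    rw [sub_ne_zero]
    rintro rfl
    simp [hr.ne] at hξ
  refine ⟨2 * Real.pi * Complex.I *
      (c / (2 * Complex.I) * ξ + (-(conj c * conj z₀) / (2 * Complex.I) - a)),
    2 * Real.pi * Complex.I * (-(conj c * r ^ 2) / (2 * Complex.I) * (1 / (z₀ - ξ))),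
    ?_, ?_, ?_⟩
  · have h1 : ContinuousAt (fun z : ℂ => 2 * Real.pi * Complex.I *
      (c / (2 * Complex.I) * z + (-(conj c * conj z₀) / (2 * Complex.I) - a))) ξ := by fun_prop
    refine (h1.tendsto.mono_left nhdsWithin_le_nhds).congr' ?_
    filter_upwards [self_mem_nhdsWithin] with z hz
    rw [imTransform_of_mem hz]
  · have h1 : ContinuousAt (fun z : ℂ => 2 * Real.pi * Complex.I *
        (-(conj c * r ^ 2) / (2 * Complex.I) * (1 / (z₀ - z)))) ξ := by
      fun_prop (disch := assumption)
    refine (h1.tendsto.mono_left nhdsWithin_le_nhds).congr' ?_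
    filter_upwards [self_mem_nhdsWithin] with z hz
    rw [imTransform_of_notMem hr, cauchyFrac_coe]
    rwa [coe_mem_image_coe]
  · rw [im_mul_sub_eq_of_mem_sphere c a hr hξ]
    have : (ξ - z₀)⁻¹ = - (1 / (z₀ - ξ)) := by
      rw [← neg_sub z₀ ξ, inv_neg, one_div]
    rw [this]
    ring

end CircleIntegrals

/-! ### Connectedness after removal of a closed disc. -/

section Connected

open Set Metric

theorem isPreconnected_annulus (z₀ : ℂ) {r s : ℝ} (hr : 0 < r) :
    IsPreconnected (ball z₀ s \ closedBall z₀ r) := by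
  have h1 : ball z₀ s \ closedBall z₀ r =
      (fun p : ℝ × ℝ => circleMap z₀ p.1 p.2) '' (Ioo r s ×ˢ univ) := by
    ext z
    constructor
    · rintro ⟨hz1, hz2⟩
      rw [mem_ball] at hz1
      rw [mem_closedBall, not_le] at hz2
      have : z ∈ range (circleMap z₀ (dist z z₀)) := by
        rw [range_circleMap, abs_of_nonneg dist_nonneg]
        exact rfl
      obtain ⟨θ, hθ⟩ := this
      exact ⟨(dist z z₀, θ), ⟨⟨hz2, hz1⟩, mem_univ _⟩, hθ⟩
    · rintro ⟨⟨ρ, θ⟩, ⟨⟨h1, h2⟩, -⟩, rfl⟩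
      have h3 : dist (circleMap z₀ ρ θ) z₀ = ρ := by
        rw [dist_eq_norm, circleMap_sub_center, norm_circleMap_zero, abs_of_pos (hr.trans h1)]
      simp only [mem_sdiff, mem_ball, mem_closedBall, h3]
      exact ⟨h2, not_le.2 h1⟩
  rw [h1]
  refine (isPreconnected_Ioo.prod isPreconnected_univ).image _ (Continuous.continuousOn ?_)
  unfold circleMap
  fun_prop

/-- A thin annulus around the ball is connected, so it falls on one side of any separation of the
complement. Filling the ball into that side would separate `U` itself. -/
theorem IsPreconnected.diff_closedBall {U : Set ℂ} (hU : IsPreconnected U) (hUo : IsOpen U)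
    {z₀ : ℂ} {r : ℝ} (hr : 0 < r) (hB : closedBall z₀ r ⊆ U) :
    IsPreconnected (U \ closedBall z₀ r) := by
  obtain ⟨δ, hδ, hδU⟩ := (isCompact_closedBall z₀ r).exists_thickening_subset_open hUo hB
  rw [thickening_closedBall hδ hr.le] at hδU
  have hA := isPreconnected_annulus z₀ (s := δ + r) hr
  have hAU : ball z₀ (δ + r) \ closedBall z₀ r ⊆ U \ closedBall z₀ r := sdiff_subset_sdiff_left hδU
  have hBV : closedBall z₀ r ⊆ ball z₀ (δ + r) := closedBall_subset_ball (by linarith)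
  rw [isPreconnected_iff_subset_of_disjoint] at hA ⊢
  have key : ∀ u v : Set ℂ, IsOpen u → IsOpen v → U \ closedBall z₀ r ⊆ u ∪ v →
      (U \ closedBall z₀ r) ∩ (u ∩ v) = ∅ → ball z₀ (δ + r) \ closedBall z₀ r ⊆ u →
      U \ closedBall z₀ r ⊆ u ∨ U \ closedBall z₀ r ⊆ v := by
    intro u v hu hv huv hd hs
    have h1 := isPreconnected_iff_subset_of_disjoint.1 hU (u \ closedBall z₀ r ∪ ball z₀ (δ + r))
      (v \ closedBall z₀ r) ((hu.sdiff isClosed_closedBall).union isOpen_ball)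
      (hv.sdiff isClosed_closedBall) ?_ ?_
    · rcases h1 with h1 | h1
      · left
        rintro z ⟨hz1, hz2⟩
        rcases h1 hz1 with h | h
        · exact h.1
        · exact hs ⟨h, hz2⟩
      · right
        rintro z ⟨hz1, hz2⟩
        exact (h1 hz1).1
    · intro z hz
      by_cases hzB : z ∈ closedBall z₀ r
      · exact Or.inl (Or.inr (hBV hzB))
      · rcases huv ⟨hz, hzB⟩ with h | h
        · exact Or.inl (Or.inl ⟨h, hzB⟩)
        · exact Or.inr ⟨h, hzB⟩
    · rw [eq_empty_iff_forall_notMem]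
      rintro z ⟨hz1, hz2, hz3, hz4⟩
      rw [eq_empty_iff_forall_notMem] at hd
      refine hd z ⟨⟨hz1, hz4⟩, ?_, hz3⟩
      rcases hz2 with h | h
      · exact h.1
      · exact hs ⟨h, hz4⟩
  intro u v hu hv huv hd
  rcases hA u v hu hv (hAU.trans huv)
    (subset_empty_iff.1 ((inter_subset_inter_left _ hAU).trans hd.subset)) with h | h
  · exact key u v hu hv huv hd h
  · exact (key v u hv hu (by rwa [union_comm]) (by rwa [inter_comm v u]) h).symm

end Connected

/-! ### Discs, reflections and ping-pong. -/

namespace CircleSystem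

open Set Filter Metric

variable {n : ℕ} (S : CircleSystem n)

/-- The open disc bounded by the circle `𝔏_j`, on the sphere. -/
def disc (j : Fin n) : Set RSphere :=
  (fun z : ℂ => (z : RSphere)) '' ball (S.center j) (S.radius j)

/-- The closed disc bounded by the circle `𝔏_j`, on the sphere. -/
def closedDisc (j : Fin n) : Set RSphere :=
  (fun z : ℂ => (z : RSphere)) '' closedBall (S.center j) (S.radius j)

theorem disc_subset_closedDisc (j : Fin n) : S.disc j ⊆ S.closedDisc j :=
  image_mono ball_subset_closedBall

theorem coe_mem_closedDisc_of_mem_circle {j : Fin n} {η : ℂ} (hη : η ∈ S.circle j) :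
    (η : RSphere) ∈ S.closedDisc j :=
  coe_mem_image_coe.2 (sphere_subset_closedBall hη)

theorem coe_notMem_disc_of_mem_circle {j : Fin n} {η : ℂ} (hη : η ∈ S.circle j) :
    (η : RSphere) ∉ S.disc j := by
  rw [disc, coe_mem_image_coe]
  exact fun h => (mem_ball.1 h).ne hη

theorem eq_of_mem_closedDisc {i j : Fin n} {p : RSphere} (hi : p ∈ S.closedDisc i)
    (hj : p ∈ S.closedDisc j) : i = j := by
  by_contra h
  obtain ⟨z, hz, rfl⟩ := hi
  rw [closedDisc, coe_mem_image_coe] at hj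
  exact disjoint_left.1 (S.disjoint h) hz hj

theorem mem_exterior_iff {p : RSphere} : p ∈ S.exterior ↔ ∀ j, p ∉ S.closedDisc j := by
  induction p using OnePoint.rec with
  | infty =>
    constructor
    · exact fun _ j => infty_notMem_image_coe
    · exact fun _ => Or.inl rfl
  | coe z =>
    simp only [closedDisc, coe_mem_image_coe, exterior, mem_union, mem_singleton_iff,
      OnePoint.coe_ne_infty, false_or, mem_ofPred_eq, mem_closedBall, not_le]

theorem infty_mem_exterior : (∞ : RSphere) ∈ S.exterior := Or.inl rfl

theorem coe_mem_exterior_iff {z : ℂ} :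
    (z : RSphere) ∈ S.exterior ↔ ∀ j, S.radius j < dist z (S.center j) := by
  simp only [mem_exterior_iff, closedDisc, coe_mem_image_coe, mem_closedBall, not_le]

theorem isOpen_exterior : IsOpen S.exterior := by
  have : S.exterior = ⋂ j, (S.closedDisc j)ᶜ := by
    ext p
    simp [mem_exterior_iff]
  rw [this]
  exact isOpen_iInter_of_finite fun j => (isClosed_image_closedBall _ _).isOpen_compl

theorem T_apply (j : Fin n) (p : RSphere) :
    S.T j p = circleReflection (S.center j) (S.radius j) p := rfl

theorem T_T (j : Fin n) (p : RSphere) : S.T j (S.T j p) = p :=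
  circleReflection_involutive _ (S.radius_pos j) p

theorem T_mul_self (j : Fin n) : S.T j * S.T j = 1 := Equiv.ext fun p => S.T_T j p

theorem T_inv (j : Fin n) : (S.T j)⁻¹ = S.T j := inv_eq_of_mul_eq_one_right (S.T_mul_self j)

theorem continuous_T (j : Fin n) : Continuous (S.T j) :=
  continuous_circleReflection _ (S.radius_pos j)

theorem T_coe_of_ne {j : Fin n} {z : ℂ} (hz : z ≠ S.center j) :
    S.T j (z : RSphere) = ((S.center j + (S.radius j : ℂ) ^ 2 /
      (conj z - conj (S.center j)) : ℂ) : RSphere) := by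
  simp [T_apply, circleReflection, hz]

theorem T_mem_disc {j : Fin n} {p : RSphere} (hp : p ∉ S.closedDisc j) : S.T j p ∈ S.disc j := by
  have hr := S.radius_pos j
  induction p using OnePoint.rec with
  | infty => exact ⟨S.center j, mem_ball_self hr, rfl⟩
  | coe z =>
    rw [closedDisc, coe_mem_image_coe, mem_closedBall, not_le] at hp
    have hz : z ≠ S.center j := by
      rintro rfl
      rw [dist_self] at hp
      exact hr.not_gt hp
    rw [S.T_coe_of_ne hz, disc, coe_mem_image_coe, mem_ball, dist_eq_norm, add_sub_cancel_left,
      norm_div, ← map_sub, RCLike.norm_conj, norm_pow, Complex.norm_real, Real.norm_of_nonneg hr.le,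
      ← dist_eq_norm, div_lt_iff₀ (hr.trans hp)]
    nlinarith

theorem T_coe_of_mem_circle {j : Fin n} {η : ℂ} (hη : η ∈ S.circle j) :
    S.T j (η : RSphere) = (η : RSphere) := by
  have hr := S.radius_pos j
  have hne : η - S.center j ≠ 0 := by
    rw [sub_ne_zero]
    rintro rfl
    simp [circle, hr.ne] at hη
  have hc : conj η - conj (S.center j) ≠ 0 := by
    rw [← map_sub]
    exact (map_ne_zero _).2 hne
  rw [S.T_coe_of_ne (sub_ne_zero.1 hne)]
  have h2 : (η - S.center j) * conj (η - S.center j) = (S.radius j : ℂ) ^ 2 := by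
    rw [Complex.mul_conj', ← dist_eq_norm, show dist η (S.center j) = S.radius j from hη]
  rw [map_sub] at h2
  refine OnePoint.coe_eq_coe.2 ?_
  field_simp
  linear_combination -h2

/-- The product of the reflections `T_j` along a word. -/
def wordProd (w : List (Fin n)) : Equiv.Perm RSphere := (w.map S.T).prod

@[simp] theorem wordProd_nil : S.wordProd [] = 1 := rfl

@[simp] theorem wordProd_cons (i : Fin n) (w : List (Fin n)) :
    S.wordProd (i :: w) = S.T i * S.wordProd w := by simp [wordProd]

@[simp] theorem wordProd_append (v w : List (Fin n)) :
    S.wordProd (v ++ w) = S.wordProd v * S.wordProd w := by simp [wordProd]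

theorem wordProd_reverse (w : List (Fin n)) : S.wordProd w.reverse = (S.wordProd w)⁻¹ := by
  induction w with
  | nil => simp
  | cons i w ih => simp [ih, T_inv]

/-- Ping-pong: each letter maps the outside of its closed disc into its disc, and the disc just
reached belongs to a different letter because the word is reduced. -/
theorem wordProd_mem_disc {w : List (Fin n)} (hw : w ≠ []) (hc : w.IsChain (· ≠ ·))
    {p : RSphere} (hp : p ∉ S.closedDisc (w.getLast hw)) :
    S.wordProd w p ∈ S.disc (w.head hw) := by
  induction w with
  | nil => exact absurd rfl hw
  | cons i w ih =>
    cases w with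
    | nil =>
      simp only [wordProd_cons, wordProd_nil, mul_one, List.head_cons]
      exact S.T_mem_disc hp
    | cons j w =>
      rw [List.isChain_cons_cons] at hc
      have h1 := ih (List.cons_ne_nil j w) hc.2 (by simpa using hp)
      rw [List.head_cons] at h1
      rw [wordProd_cons, List.head_cons]
      exact S.T_mem_disc fun h =>
        hc.1 (S.eq_of_mem_closedDisc h (S.disc_subset_closedDisc j h1))

theorem wordProd_mem_disc_of_mem_exterior {w : List (Fin n)} (hw : w ≠ [])
    (hc : w.IsChain (· ≠ ·)) {p : RSphere} (hp : p ∈ S.exterior) :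
    S.wordProd w p ∈ S.disc (w.head hw) :=
  S.wordProd_mem_disc hw hc (S.mem_exterior_iff.1 hp _)

/-- A last letter `l` fixes the points of its own circle and may be dropped; the word `[l]` is
excluded because nothing would be left to move the point off the circle. -/
theorem wordProd_mem_disc_of_mem_circle {w : List (Fin n)} (hw : w ≠ []) (hc : w.IsChain (· ≠ ·))
    {l : Fin n} (hl : w ≠ [l]) {η : ℂ} (hη : η ∈ S.circle l) :
    S.wordProd w (η : RSphere) ∈ S.disc (w.head hw) := by
  have hη' := S.coe_mem_closedDisc_of_mem_circle hη
  by_cases h : w.getLast hw = l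
  · have h1 := List.dropLast_append_getLast hw
    rw [h] at h1
    generalize w.dropLast = v at h1
    subst h1
    have hv : v ≠ [] := by
      rintro rfl
      exact hl rfl
    rw [wordProd_append, wordProd_cons, wordProd_nil, mul_one, Equiv.Perm.mul_apply,
      S.T_coe_of_mem_circle hη, List.head_append_of_ne_nil hv]
    rw [List.isChain_append] at hc
    refine S.wordProd_mem_disc hv hc.1 fun h' => ?_
    have h2 := S.eq_of_mem_closedDisc h' hη'
    refine hc.2.2 (v.getLast hv) ?_ l ?_ h2
    · simp [List.getLast?_eq_getLast_of_ne_nil hv]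
    · simp
  · exact S.wordProd_mem_disc hw hc fun h' => h (S.eq_of_mem_closedDisc h' hη')

/-- Cancellation removes letters in pairs, so parity survives; even words are those of the Schottky
group. -/
theorem exists_reduced_word (w : List (Fin n)) :
    ∃ v : List (Fin n), v.IsChain (· ≠ ·) ∧ S.wordProd v = S.wordProd w ∧
      (Even v.length ↔ Even w.length) := by
  induction w with
  | nil => exact ⟨[], by simp, rfl, Iff.rfl⟩
  | cons i w ih =>
    obtain ⟨v, hv, hvw, he⟩ := ih
    cases v with
    | nil =>
      refine ⟨[i], by simp, by simp [← hvw], ?_⟩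
      simp only [List.length_cons, Nat.even_add_one, he]
    | cons j v =>
      by_cases hij : i = j
      · subst hij
        refine ⟨v, hv.of_cons, ?_, ?_⟩
        · rw [wordProd_cons, ← hvw, wordProd_cons, ← mul_assoc, T_mul_self, one_mul]
        · rw [List.length_cons, Nat.even_add_one, ← he, List.length_cons, Nat.even_add_one, not_not]
      · refine ⟨i :: j :: v, List.isChain_cons_cons.2 ⟨hij, hv⟩, by rw [wordProd_cons, hvw,
          wordProd_cons], ?_⟩
        rw [List.length_cons, Nat.even_add_one, he, List.length_cons, Nat.even_add_one]

/-- The group generated by the reflections `T_j`. -/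
def reflectionGroup : Subgroup (Equiv.Perm RSphere) := Subgroup.closure (range S.T)

theorem T_mem_reflectionGroup (j : Fin n) : S.T j ∈ S.reflectionGroup :=
  Subgroup.subset_closure ⟨j, rfl⟩

theorem exists_word_of_mem_reflectionGroup {g : Equiv.Perm RSphere} (hg : g ∈ S.reflectionGroup) :
    ∃ w : List (Fin n), w.IsChain (· ≠ ·) ∧ g = S.wordProd w := by
  suffices h : ∃ w : List (Fin n), g = S.wordProd w by
    obtain ⟨w, rfl⟩ := h
    obtain ⟨v, hv, e, -⟩ := S.exists_reduced_word w
    exact ⟨v, hv, e.symm⟩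
  induction hg using Subgroup.closure_induction with
  | mem x hx =>
    obtain ⟨j, rfl⟩ := hx
    exact ⟨[j], by simp⟩
  | one => exact ⟨[], rfl⟩
  | mul x y _ _ hx hy =>
    obtain ⟨v, rfl⟩ := hx
    obtain ⟨w, rfl⟩ := hy
    exact ⟨v ++ w, by simp⟩
  | inv x _ hx =>
    obtain ⟨v, rfl⟩ := hx
    exact ⟨v.reverse, (S.wordProd_reverse v).symm⟩

theorem continuous_of_mem_reflectionGroup {g : Equiv.Perm RSphere}
    (hg : g ∈ S.reflectionGroup) : Continuous g := by
  obtain ⟨w, -, rfl⟩ := S.exists_word_of_mem_reflectionGroup hg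
  induction w with
  | nil => exact continuous_id
  | cons i w ih =>
    rw [wordProd_cons]
    exact (S.continuous_T i).comp (ih (S.reflectionGroup.mul_mem
      (S.T_mem_reflectionGroup i) hg |> fun h => by
        rwa [wordProd_cons, ← mul_assoc, T_mul_self, one_mul] at h))

theorem coe_ne_of_mem_reflectionGroup {g : Equiv.Perm RSphere} (hg : g ∈ S.reflectionGroup)
    {p : RSphere} (hp : p ∈ S.exterior) {l : Fin n} {η : ℂ} (hη : η ∈ S.circle l) :
    g p ≠ (η : RSphere) := by
  obtain ⟨w, hw, rfl⟩ := S.exists_word_of_mem_reflectionGroup hg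
  have hη' := S.coe_mem_closedDisc_of_mem_circle hη
  intro e
  by_cases hn : w = []
  · subst hn
    rw [wordProd_nil, Equiv.Perm.one_apply] at e
    rw [e] at hp
    exact S.mem_exterior_iff.1 hp l hη'
  · have h1 := S.wordProd_mem_disc_of_mem_exterior hn hw hp
    rw [e] at h1
    have h2 := S.eq_of_mem_closedDisc (S.disc_subset_closedDisc _ h1) hη'
    rw [h2] at h1
    exact S.coe_notMem_disc_of_mem_circle hη h1

/-! ### The Schottky group inside the reflection group. -/

section Schottky

variable [NeZero n]

theorem sigma_mem_schottky (j : Fin n) : S.sigma j ∈ S.schottky :=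
  Subgroup.subset_closure ⟨j, rfl⟩

theorem sigma_inv (j : Fin n) : (S.sigma j)⁻¹ = S.T 0 * S.T j := by
  rw [sigma, mul_inv_rev, T_inv, T_inv]

theorem T_zero_conj_sigma (j : Fin n) : S.T 0 * S.sigma j * S.T 0 = (S.sigma j)⁻¹ := by
  rw [sigma_inv, sigma, mul_assoc, mul_assoc, T_mul_self, mul_one]

theorem schottky_le_reflectionGroup : S.schottky ≤ S.reflectionGroup := by
  refine (Subgroup.closure_le _).2 ?_
  rintro _ ⟨j, rfl⟩
  exact mul_mem (S.T_mem_reflectionGroup j) (S.T_mem_reflectionGroup 0)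

theorem exists_word_of_mem_schottky {σ : Equiv.Perm RSphere} (hσ : σ ∈ S.schottky) :
    ∃ w : List (Fin n), w.IsChain (· ≠ ·) ∧ Even w.length ∧ σ = S.wordProd w := by
  suffices h : ∃ w : List (Fin n), Even w.length ∧ σ = S.wordProd w by
    obtain ⟨w, hw, rfl⟩ := h
    obtain ⟨v, hv, e, h⟩ := S.exists_reduced_word w
    exact ⟨v, hv, h.2 hw, e.symm⟩
  induction hσ using Subgroup.closure_induction with
  | mem x hx =>
    obtain ⟨j, rfl⟩ := hx
    exact ⟨[j, 0], ⟨1, rfl⟩, by simp [sigma]⟩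
  | one => exact ⟨[], by simp, rfl⟩
  | mul x y _ _ hx hy =>
    obtain ⟨v, hv, rfl⟩ := hx
    obtain ⟨w, hw, rfl⟩ := hy
    exact ⟨v ++ w, by simpa using hv.add hw, by simp⟩
  | inv x _ hx =>
    obtain ⟨v, hv, rfl⟩ := hx
    exact ⟨v.reverse, by simpa using hv, (S.wordProd_reverse v).symm⟩

/-- Conjugation by the involution `T 0` inverts each generator, hence normalizes the group. -/
theorem T_zero_conj_mem_schottky {σ : Equiv.Perm RSphere} (hσ : σ ∈ S.schottky) :
    S.T 0 * σ * S.T 0 ∈ S.schottky := by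
  induction hσ using Subgroup.closure_induction with
  | mem x hx =>
    obtain ⟨j, rfl⟩ := hx
    rw [T_zero_conj_sigma]
    exact inv_mem (S.sigma_mem_schottky j)
  | one => simp [T_mul_self, one_mem]
  | mul x y _ _ hx hy =>
    have : S.T 0 * (x * y) * S.T 0 = (S.T 0 * x * S.T 0) * (S.T 0 * y * S.T 0) := by
      have h : S.T 0 * x * S.T 0 * (S.T 0 * y * S.T 0) =
        S.T 0 * x * (S.T 0 * S.T 0) * y * S.T 0 := by group
      rw [h, T_mul_self]
      group
    rw [this]
    exact mul_mem hx hy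
  | inv x _ hx =>
    have : S.T 0 * x⁻¹ * S.T 0 = (S.T 0 * x * S.T 0)⁻¹ := by
      rw [mul_inv_rev, mul_inv_rev, T_inv, mul_assoc]
    rw [this]
    exact inv_mem hx

/-- The Schottky group has index at most two in the reflection group, with `T 0` representing the
other coset. -/
theorem mem_schottky_or_of_mem_reflectionGroup {g : Equiv.Perm RSphere}
    (hg : g ∈ S.reflectionGroup) : g ∈ S.schottky ∨ g * S.T 0 ∈ S.schottky := by
  obtain ⟨w, -, rfl⟩ := S.exists_word_of_mem_reflectionGroup hg
  clear hg
  induction w with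
  | nil => exact Or.inl (one_mem _)
  | cons i w ih =>
    have key : S.T i * S.wordProd w = S.sigma i * (S.T 0 * S.wordProd w) := by
      rw [sigma, mul_assoc, ← mul_assoc (S.T 0) (S.T 0), T_mul_self, one_mul]
    rw [wordProd_cons, key]
    rcases ih with h | h
    · right
      rw [mul_assoc]
      exact mul_mem (S.sigma_mem_schottky i) (S.T_zero_conj_mem_schottky h)
    · left
      have h2 := S.T_zero_conj_mem_schottky h
      rw [mul_assoc, mul_assoc, T_mul_self, mul_one] at h2
      exact mul_mem (S.sigma_mem_schottky i) h2

/-- Viewing the pieces as the orbit of the exterior under all reflections makes their invariance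
under every `T j` evident. -/
theorem mem_pieces_iff {p : RSphere} :
    p ∈ S.pieces ↔ ∃ g ∈ S.reflectionGroup, ∃ q ∈ S.exterior, g q = p := by
  simp only [pieces, mem_iUnion, mem_image, mem_union]
  constructor
  · rintro ⟨σ, hσ, q, hq | ⟨q', hq', rfl⟩, rfl⟩
    · exact ⟨σ, S.schottky_le_reflectionGroup hσ, q, hq, rfl⟩
    · exact ⟨σ * S.T 0, mul_mem (S.schottky_le_reflectionGroup hσ) (S.T_mem_reflectionGroup 0),
        q', hq', rfl⟩
  · rintro ⟨g, hg, q, hq, rfl⟩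
    rcases S.mem_schottky_or_of_mem_reflectionGroup hg with h | h
    · exact ⟨g, h, q, Or.inl hq, rfl⟩
    · refine ⟨g * S.T 0, h, S.T 0 q, Or.inr ⟨q, hq, rfl⟩, ?_⟩
      rw [Equiv.Perm.mul_apply, T_T]

theorem exterior_subset_pieces : S.exterior ⊆ S.pieces := fun p hp =>
  S.mem_pieces_iff.2 ⟨1, one_mem _, p, hp, rfl⟩

theorem apply_mem_pieces {g : Equiv.Perm RSphere} (hg : g ∈ S.reflectionGroup) {p : RSphere}
    (hp : p ∈ S.pieces) : g p ∈ S.pieces := by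
  obtain ⟨h, hh, q, hq, rfl⟩ := S.mem_pieces_iff.1 hp
  exact S.mem_pieces_iff.2 ⟨g * h, mul_mem hg hh, q, hq, rfl⟩

theorem T_mem_pieces (j : Fin n) {p : RSphere} (hp : p ∈ S.pieces) : S.T j p ∈ S.pieces :=
  S.apply_mem_pieces (S.T_mem_reflectionGroup j) hp

theorem schottky_apply_mem_pieces {σ : Equiv.Perm RSphere} (hσ : σ ∈ S.schottky) {p : RSphere}
    (hp : p ∈ S.pieces) : σ p ∈ S.pieces :=
  S.apply_mem_pieces (S.schottky_le_reflectionGroup hσ) hp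

theorem isOpen_pieces : IsOpen S.pieces := by
  have : S.pieces = ⋃ g ∈ S.reflectionGroup, g ⁻¹' S.exterior := by
    ext p
    simp only [mem_pieces_iff, mem_iUnion, mem_preimage]
    constructor
    · rintro ⟨g, hg, q, hq, rfl⟩
      exact ⟨g⁻¹, inv_mem hg, by simpa using hq⟩
    · rintro ⟨g, hg, hp⟩
      exact ⟨g⁻¹, inv_mem hg, g p, hp, by simp⟩
  rw [this]
  exact isOpen_biUnion fun g hg =>
    S.isOpen_exterior.preimage (S.continuous_of_mem_reflectionGroup hg)

theorem apply_circle_notMem_pieces {g : Equiv.Perm RSphere} (hg : g ∈ S.reflectionGroup)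
    {l : Fin n} {η : ℂ} (hη : η ∈ S.circle l) : g (η : RSphere) ∉ S.pieces := by
  intro h
  obtain ⟨h, hh, q, hq, e⟩ := S.mem_pieces_iff.1 h
  refine S.coe_ne_of_mem_reflectionGroup (mul_mem (inv_mem hg) hh) hq hη ?_
  rw [Equiv.Perm.mul_apply, e]
  exact g.symm_apply_apply _

theorem coe_circle_notMem_pieces {l : Fin n} {η : ℂ} (hη : η ∈ S.circle l) :
    (η : RSphere) ∉ S.pieces :=
  S.apply_circle_notMem_pieces (one_mem _) hη

theorem infty_mem_pieces : (∞ : RSphere) ∈ S.pieces :=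
  S.exterior_subset_pieces S.infty_mem_exterior

theorem schottky_apply_circle_mem_disc {σ : Equiv.Perm RSphere} (hσ : σ ∈ S.schottky)
    (h1 : σ ≠ 1) {l : Fin n} {η : ℂ} (hη : η ∈ S.circle l) :
    ∃ j, σ (η : RSphere) ∈ S.disc j := by
  obtain ⟨w, hw, he, rfl⟩ := S.exists_word_of_mem_schottky hσ
  have hn : w ≠ [] := by
    rintro rfl
    exact h1 rfl
  refine ⟨_, S.wordProd_mem_disc_of_mem_circle hn hw ?_ hη⟩
  rintro rfl
  simp at he

theorem schottky_apply_circle_ne {σ : Equiv.Perm RSphere} (hσ : σ ∈ S.schottky)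
    (h1 : σ ≠ 1) {l m : Fin n} {η ξ : ℂ} (hη : η ∈ S.circle l) (hξ : ξ ∈ S.circle m) :
    σ (η : RSphere) ≠ (ξ : RSphere) := by
  intro e
  obtain ⟨j, hj⟩ := S.schottky_apply_circle_mem_disc hσ h1 hη
  rw [e] at hj
  have := S.eq_of_mem_closedDisc (S.disc_subset_closedDisc _ hj)
    (S.coe_mem_closedDisc_of_mem_circle hξ)
  subst this
  exact S.coe_notMem_disc_of_mem_circle hξ hj

/-- A nontrivial σ has a reduced word of length at least two, so σ(∞) lies in the image under some
`T i` of a closed disc with index j ≠ i. These finitely many images are compact and miss every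
circle. -/
theorem exists_pos_forall_le_dist :
    ∃ d : ℝ, 0 < d ∧ ∀ σ ∈ S.schottky, σ ≠ 1 → ∃ v : ℂ, σ ∞ = (v : RSphere) ∧
      ∀ l, ∀ η ∈ S.circle l, d ≤ dist v η := by
  set f : Fin n → ℂ → ℂ := fun i z =>
    S.center i + (S.radius i : ℂ) ^ 2 / (conj z - conj (S.center i)) with hf
  set K : Set ℂ := ⋃ i, ⋃ j, ⋃ _ : i ≠ j, f i '' closedBall (S.center j) (S.radius j) with hK
  have hne : ∀ {i j : Fin n}, i ≠ j → ∀ z ∈ closedBall (S.center j) (S.radius j),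
      z ≠ S.center i := by
    rintro i j hij z hz rfl
    exact disjoint_left.1 (S.disjoint hij) (mem_closedBall_self (S.radius_pos i).le) hz
  have hTf : ∀ {i j : Fin n}, i ≠ j → ∀ z ∈ closedBall (S.center j) (S.radius j),
      S.T i (z : RSphere) = (f i z : RSphere) := fun hij z hz => S.T_coe_of_ne (hne hij z hz)
  have hKc : IsCompact K := by
    refine isCompact_iUnion fun i => isCompact_iUnion fun j => isCompact_iUnion fun hij => ?_
    refine (isCompact_closedBall _ _).image_of_continuousOn fun z hz => ?_
    have h1 : conj z - conj (S.center i) ≠ 0 := by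
      rw [← map_sub]
      exact (map_ne_zero _).2 (sub_ne_zero.2 (hne hij z hz))
    have h2 : ContinuousAt (fun z : ℂ => conj z - conj (S.center i)) z :=
      (Complex.continuous_conj.sub continuous_const).continuousAt
    exact (continuousAt_const.add (continuousAt_const.div h2 h1)).continuousWithinAt
  have hC : IsClosed (⋃ l, S.circle l) := isClosed_iUnion_of_finite fun l => isClosed_sphere
  have hd : Disjoint K (⋃ l, S.circle l) := by
    rw [disjoint_left]
    intro v hv hv'
    simp only [hK, mem_iUnion] at hv hv'
    obtain ⟨i, j, hij, z, hz, rfl⟩ := hv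
    obtain ⟨l, hl⟩ := hv'
    have h1 : S.T i (z : RSphere) ∈ S.disc i := S.T_mem_disc fun h =>
      hij (S.eq_of_mem_closedDisc h (coe_mem_image_coe.2 hz))
    rw [hTf hij z hz] at h1
    have := S.eq_of_mem_closedDisc (S.disc_subset_closedDisc _ h1)
      (S.coe_mem_closedDisc_of_mem_circle hl)
    subst this
    exact S.coe_notMem_disc_of_mem_circle hl h1
  obtain ⟨r, hr, h⟩ := exists_pos_forall_lt_edist hKc hC hd
  refine ⟨r, hr, fun σ hσ h1 => ?_⟩
  obtain ⟨w, hw, he, rfl⟩ := S.exists_word_of_mem_schottky hσ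
  match w, hw, he, h1 with
  | [], _, _, h1 => exact absurd rfl h1
  | [i], _, he, _ => simp at he
  | i :: j :: w, hw, _, _ =>
    rw [List.isChain_cons_cons] at hw
    have h2 := S.wordProd_mem_disc_of_mem_exterior (List.cons_ne_nil j w) hw.2
      S.infty_mem_exterior
    rw [List.head_cons] at h2
    obtain ⟨z, hz, e⟩ := S.disc_subset_closedDisc _ h2
    simp only at e
    rw [wordProd_cons, Equiv.Perm.mul_apply, ← e]
    refine ⟨f i z, hTf hw.1 z hz, fun l η hη => ?_⟩
    have h3 := h (f i z) (mem_iUnion.2 ⟨i, mem_iUnion.2 ⟨j, mem_iUnion.2 ⟨hw.1, z, hz, rfl⟩⟩⟩) η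
      (mem_iUnion.2 ⟨l, hη⟩)
    rw [edist_nndist] at h3
    exact (by exact_mod_cast h3 : r < nndist (f i z) η).le

theorem sigma_apply_mem_disc {j : Fin n} (hj : j ≠ 0) {p : RSphere} (hp : p ∈ S.exterior) :
    S.sigma j p ∈ S.disc j := by
  have := S.wordProd_mem_disc_of_mem_exterior (w := [j, 0]) (by simp) (by simpa using hj) hp
  simpa [sigma] using this

theorem sigma_inv_apply_mem_disc {j : Fin n} (hj : j ≠ 0) {p : RSphere} (hp : p ∈ S.exterior) :
    (S.sigma j)⁻¹ p ∈ S.disc 0 := by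
  have := S.wordProd_mem_disc_of_mem_exterior (w := [0, j]) (by simp) (by simpa using hj.symm) hp
  simpa [sigma_inv] using this

/-- Appending the word `[j, 0]` of σ_j to the word of σ can cancel letters only at the right end.
The first letter, which decides the disc, is reached only by the empty word and by `[0, j]`, the
word of σ_j⁻¹. -/
theorem exists_disc_of_ne {j : Fin n} {p : RSphere} (hp : p ∈ S.exterior)
    {σ : Equiv.Perm RSphere} (hσ : σ ∈ S.schottky) (h1 : σ ≠ 1) (h2 : σ ≠ (S.sigma j)⁻¹)
    (hj : j ≠ 0) :
    ∃ a, σ p ∈ S.disc a ∧ σ (S.sigma j p) ∈ S.disc a := by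
  obtain ⟨w, hw, he, rfl⟩ := S.exists_word_of_mem_schottky hσ
  have hn : w ≠ [] := by
    rintro rfl
    exact h1 rfl
  refine ⟨w.head hn, S.wordProd_mem_disc_of_mem_exterior hn hw hp, ?_⟩
  by_cases h : w.getLast hn = j
  · have e1 := List.dropLast_append_getLast hn
    rw [h] at e1
    generalize w.dropLast = v at e1
    subst e1
    have hv : v ≠ [] := by
      rintro rfl
      simp at he
    rw [List.isChain_append] at hw
    rw [List.head_append_of_ne_nil hv]
    have e2 : S.wordProd (v ++ [j]) (S.sigma j p) = S.wordProd v (S.T 0 p) := by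
      simp [sigma, T_T]
    rw [e2]
    by_cases h0 : v.getLast hv = 0
    · have e3 := List.dropLast_append_getLast hv
      rw [h0] at e3
      generalize v.dropLast = u at e3
      subst e3
      have hu : u ≠ [] := by
        rintro rfl
        refine h2 ?_
        simp [sigma_inv]
      rw [List.isChain_append] at hw
      rw [List.head_append_of_ne_nil hu]
      have e4 : S.wordProd (u ++ [0]) (S.T 0 p) = S.wordProd u p := by simp [T_T]
      rw [e4]
      exact S.wordProd_mem_disc_of_mem_exterior hu hw.1.1 hp
    · refine S.wordProd_mem_disc hv hw.1 fun h' => h0 ?_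
      exact S.eq_of_mem_closedDisc h'
        (S.disc_subset_closedDisc _ (S.T_mem_disc (S.mem_exterior_iff.1 hp 0)))
  · refine S.wordProd_mem_disc hn hw fun h' => h ?_
    exact S.eq_of_mem_closedDisc h' (S.disc_subset_closedDisc _ (S.sigma_apply_mem_disc hj hp))

theorem countable_schottky : Countable S.schottky := by
  have : Function.Surjective (fun w : {w : List (Fin n) // S.wordProd w ∈ S.schottky} =>
      (⟨S.wordProd w.1, w.2⟩ : S.schottky)) := by
    rintro ⟨σ, hσ⟩
    obtain ⟨w, -, -, rfl⟩ := S.exists_word_of_mem_schottky hσ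
    exact ⟨⟨w, hσ⟩, rfl⟩
  exact this.countable

end Schottky

end CircleSystem

/-! ### Convergence, quasiautomorphy and the integrals of the kernel. -/

namespace CircleSystem

open Set Filter Metric

variable {n : ℕ} (S : CircleSystem n) [NeZero n]

theorem schottky_apply_circle_ne_infty {σ : Equiv.Perm RSphere} (hσ : σ ∈ S.schottky)
    {l : Fin n} {η : ℂ} (hη : η ∈ S.circle l) : σ (η : RSphere) ≠ ∞ := fun e =>
  S.apply_circle_notMem_pieces (S.schottky_le_reflectionGroup hσ) hη (e ▸ S.infty_mem_pieces)

/-- Matrices of the elements of the Schottky group together with a summable bound of their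
derivatives on the circles. -/
structure MoebiusData where
  matrix : S.schottky → GL (Fin 2) ℂ
  bound : S.schottky → ℝ
  apply_eq : ∀ (σ : S.schottky) (p : RSphere), (σ : Equiv.Perm RSphere) p = matrix σ • p
  summable : Summable bound
  bound_nonneg : ∀ σ, 0 ≤ bound σ
  norm_deriv_le : ∀ (σ : S.schottky) (l : Fin n), ∀ η ∈ S.circle l,
    ‖deriv (fun z : ℂ => finPart ((σ : Equiv.Perm RSphere) z)) η‖ ≤ bound σ

theorem den_ne_zero_of_mem_circle {σ : Equiv.Perm RSphere} (hσ : σ ∈ S.schottky)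
    {N : GL (Fin 2) ℂ} (hN : ∀ p : RSphere, σ p = N • p) {l : Fin n} {η : ℂ}
    (hη : η ∈ S.circle l) : N 1 0 * η + N 1 1 ≠ 0 := by
  rw [← smul_coe_ne_infty_iff, ← hN]
  exact S.schottky_apply_circle_ne_infty hσ hη

theorem deriv_finPart_apply {σ : Equiv.Perm RSphere} (hσ : σ ∈ S.schottky)
    {N : GL (Fin 2) ℂ} (hN : ∀ p : RSphere, σ p = N • p) {l : Fin n} {η : ℂ}
    (hη : η ∈ S.circle l) :
    deriv (fun z : ℂ => finPart (σ z)) η =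
      (N 0 0 * N 1 1 - N 0 1 * N 1 0) / (N 1 0 * η + N 1 1) ^ 2 := by
  simp only [hN]
  exact (hasDerivAt_finPart_smul N (S.den_ne_zero_of_mem_circle hσ hN hη)).deriv

theorem FirstClass.nonempty_moebiusData {S : CircleSystem n} (hS : S.FirstClass) :
    Nonempty S.MoebiusData := by
  classical
  obtain ⟨M, hM, hsum⟩ := hS
  obtain ⟨d, hd, hdist⟩ := S.exists_pos_forall_le_dist
  set f : S.schottky → ℝ := fun σ => ‖(M σ : Matrix (Fin 2) (Fin 2) ℂ).det‖ /
    ‖(M σ : Matrix (Fin 2) (Fin 2) ℂ) 1 0‖ ^ 2 with hf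
  have hsum1 : Summable (Set.indicator {σ : S.schottky | σ ≠ 1} f) :=
    summable_subtype_iff_indicator.1 hsum
  have hsum2 : Summable (Set.indicator ({1} : Set S.schottky) fun _ => (1 : ℝ)) :=
    summable_of_hasFiniteSupport (((finite_singleton _).subset support_indicator_subset))
  have hnn : ∀ σ, 0 ≤ Set.indicator {σ : S.schottky | σ ≠ 1} f σ := fun σ =>
    indicator_nonneg (fun σ _ => by positivity) σ
  have hnn' : ∀ σ, 0 ≤ Set.indicator ({1} : Set S.schottky) (fun _ => (1 : ℝ)) σ := fun σ =>
    indicator_nonneg (fun σ _ => zero_le_one) σ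
  -- The identity is absent from the first-class series; its derivative 1 is supplied by the second
  -- indicator.
  refine ⟨⟨M, fun σ => Set.indicator {σ : S.schottky | σ ≠ 1} f σ / d ^ 2 +
    Set.indicator ({1} : Set S.schottky) (fun _ => (1 : ℝ)) σ, hM,
    (hsum1.div_const _).add hsum2, fun σ => ?_, fun σ l η hη => ?_⟩⟩
  · exact add_nonneg (div_nonneg (hnn σ) (sq_nonneg d)) (hnn' σ)
  by_cases h1 : σ = 1
  · subst h1
    have : deriv (fun z : ℂ => finPart (((1 : S.schottky) : Equiv.Perm RSphere) z)) η = 1 :=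
      deriv_id η
    rw [this, norm_one]
    refine le_add_of_nonneg_of_le (div_nonneg (hnn _) (sq_nonneg d)) ?_
    simp
  · have h1' : (σ : Equiv.Perm RSphere) ≠ 1 := fun e => h1 (Subtype.ext e)
    refine le_add_of_le_of_nonneg ?_ (hnn' σ)
    rw [S.deriv_finPart_apply σ.2 (hM σ) hη, indicator_of_mem (by exact h1)]
    have hdet : (M σ : Matrix (Fin 2) (Fin 2) ℂ).det =
        M σ 0 0 * M σ 1 1 - M σ 0 1 * M σ 1 0 := Matrix.det_fin_two _
    simp only [hf, hdet]
    obtain ⟨v', hv', -⟩ := hdist σ σ.2 h1'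
    -- With v = σ⁻¹(∞) the denominator is γη + δ = -γ(v - η), so |σ'(η)| = |det|/(|γ|²|v - η|²) and
    -- |v - η| ≥ d.
    obtain ⟨v, hv, hvd⟩ := hdist (σ : Equiv.Perm RSphere)⁻¹ (inv_mem σ.2) (inv_ne_one.2 h1')
    have hc : M σ 1 0 ≠ 0 := by
      intro hc
      rw [hM, OnePoint.smul_infty_eq_ite, if_pos hc] at hv'
      exact OnePoint.infty_ne_coe _ hv'
    have hv2 : (σ : Equiv.Perm RSphere) (v : RSphere) = ∞ := by
      rw [← hv]
      exact (σ : Equiv.Perm RSphere).apply_symm_apply _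
    have hv3 : M σ 1 0 * v + M σ 1 1 = 0 := by
      by_contra h
      rw [hM] at hv2
      exact smul_coe_ne_infty_iff.2 h hv2
    have e : M σ 1 0 * η + M σ 1 1 = -(M σ 1 0 * (v - η)) := by linear_combination hv3
    rw [e, neg_sq, mul_pow, norm_div, norm_mul, norm_pow, norm_pow, ← dist_eq_norm v η, div_div]
    have hc' : 0 < ‖M σ 1 0‖ := norm_pos_iff.2 hc
    have := hvd l η hη
    gcongr

variable {S}

/-- The images of the circles under the Schottky group avoid `S.pieces`. -/
theorem apply_circle_ne_of_mem_pieces {ζ : RSphere} (hζ : ζ ∈ S.pieces)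
    {σ : Equiv.Perm RSphere} (hσ : σ ∈ S.schottky) {l : Fin n} {η : ℂ} (hη : η ∈ S.circle l) :
    ζ ≠ σ (η : RSphere) := fun e =>
  S.apply_circle_notMem_pieces (S.schottky_le_reflectionGroup hσ) hη (e ▸ hζ)

namespace MoebiusData

variable (D : S.MoebiusData)
include D

/-- The condition on ζ is weaker than membership in the pieces because the terms with σ ≠ 1 are
later followed up to and across the circles. -/
theorem kernelTerm_eq {ζs ζ : RSphere} (hζs : ζs ∈ S.pieces) {l : Fin n} {η : ℂ}
    (hη : η ∈ S.circle l) {σ : S.schottky} (hζ : ζ ≠ (σ : Equiv.Perm RSphere) (η : RSphere)) :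
    S.kernelTerm ζs ζ η σ =
      cauchyFrac η ((σ⁻¹ : S.schottky).1 ζ) - cauchyFrac η ((σ⁻¹ : S.schottky).1 ζs) := by
  have hd := S.den_ne_zero_of_mem_circle σ.2 (D.apply_eq σ) hη
  have key : ∀ p : RSphere, p ≠ (σ : Equiv.Perm RSphere) (η : RSphere) →
      cauchyFrac (finPart ((σ : Equiv.Perm RSphere) η)) p *
        deriv (fun z : ℂ => finPart ((σ : Equiv.Perm RSphere) z)) η =
      cauchyFrac η ((σ⁻¹ : S.schottky).1 p) -
        D.matrix σ 1 0 / (D.matrix σ 1 0 * η + D.matrix σ 1 1) := by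
    intro p hp
    have hp' : (σ⁻¹ : S.schottky).1 p ≠ (η : RSphere) := by
      intro e
      apply hp
      rw [← e]
      exact ((σ : Equiv.Perm RSphere).apply_symm_apply _).symm
    rw [← cauchyFrac_smul (D.matrix σ) hd hp', S.deriv_finPart_apply σ.2 (D.apply_eq σ) hη,
      ← D.apply_eq, D.apply_eq σ η, smul_coe_of_ne hd, finPart_coe]
    congr 2
    exact ((σ : Equiv.Perm RSphere).apply_symm_apply _).symm
  rw [kernelTerm, sub_mul, key ζ hζ, key ζs (apply_circle_ne_of_mem_pieces hζs σ.2 hη)]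
  ring

theorem norm_kernelTerm_le {ζs ζ : RSphere} {l : Fin n} {η : ℂ} (hη : η ∈ S.circle l)
    {σ : S.schottky} {B B' : ℝ}
    (hB : ‖cauchyFrac (finPart ((σ : Equiv.Perm RSphere) η)) ζ‖ ≤ B)
    (hB' : ‖cauchyFrac (finPart ((σ : Equiv.Perm RSphere) η)) ζs‖ ≤ B') :
    ‖S.kernelTerm ζs ζ η σ‖ ≤ (B + B') * D.bound σ := by
  rw [kernelTerm, norm_mul]
  have h0 : 0 ≤ B + B' := add_nonneg ((norm_nonneg _).trans hB) ((norm_nonneg _).trans hB')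
  exact mul_le_mul ((norm_sub_le _ _).trans (add_le_add hB hB')) (D.norm_deriv_le σ l η hη)
    (norm_nonneg _) h0

end MoebiusData

theorem norm_cauchyFrac_le {v z w : ℂ} {δ : ℝ} (hδ : 0 < δ) (hv : v ∉ ball z (2 * δ))
    (hw : w ∈ ball z δ) : ‖cauchyFrac v (w : RSphere)‖ ≤ 1 / δ := by
  rw [cauchyFrac_coe, norm_div, norm_one]
  have h1 : 2 * δ ≤ dist v z := not_lt.1 hv
  have h2 : dist w z < δ := hw
  have h3 := dist_triangle v w z
  rw [← dist_eq_norm]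
  exact one_div_le_one_div_of_le hδ (by linarith)

theorem finPart_apply_circle_notMem {σ : Equiv.Perm RSphere} (hσ : σ ∈ S.schottky)
    {l : Fin n} {η : ℂ} (hη : η ∈ S.circle l) :
    ((finPart (σ (η : RSphere)) : ℂ) : RSphere) ∉ S.pieces := by
  rw [coe_finPart (S.schottky_apply_circle_ne_infty hσ hη)]
  exact S.apply_circle_notMem_pieces (S.schottky_le_reflectionGroup hσ) hη

/-- The images of the circles avoid the open set of pieces, which handles finite points; they all
lie in the closed discs, a bounded set, which handles `∞`. -/
theorem exists_nhds_bound {p : RSphere} (hp : p ∈ S.pieces) :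
    ∃ V ∈ 𝓝 p, V ⊆ S.pieces ∧ ∃ B : ℝ, ∀ ζ ∈ V, ∀ σ ∈ S.schottky, ∀ l : Fin n,
      ∀ η ∈ S.circle l, ‖cauchyFrac (finPart (σ (η : RSphere))) ζ‖ ≤ B := by
  induction p using OnePoint.rec with
  | infty =>
    obtain ⟨R, hR⟩ : ∃ R : ℝ, (⋃ j, closedBall (S.center j) (S.radius j)) ⊆ closedBall 0 R :=
      (Bornology.isBounded_iUnion.2 fun j => isBounded_closedBall).subset_closedBall 0
    refine ⟨S.pieces ∩ ((fun z : ℂ => (z : RSphere)) '' closedBall 0 (R + 1))ᶜ,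
      inter_mem (S.isOpen_pieces.mem_nhds hp)
        ((isClosed_image_closedBall 0 (R + 1)).isOpen_compl.mem_nhds infty_notMem_image_coe),
      inter_subset_left, 1, ?_⟩
    rintro ζ ⟨-, hζ⟩ σ hσ l η hη
    have h1 : ∃ j, σ (η : RSphere) ∈ S.closedDisc j := by
      by_cases h : σ = 1
      · subst h
        exact ⟨l, S.coe_mem_closedDisc_of_mem_circle hη⟩
      · obtain ⟨j, hj⟩ := S.schottky_apply_circle_mem_disc hσ h hη
        exact ⟨j, S.disc_subset_closedDisc j hj⟩
    obtain ⟨j, z, hz, e⟩ := h1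
    simp only at e
    rw [← e, finPart_coe]
    have hz' : z ∈ closedBall (0 : ℂ) R := hR (mem_iUnion.2 ⟨j, hz⟩)
    rw [mem_closedBall, dist_zero_right] at hz'
    induction ζ using OnePoint.rec with
    | infty => simp [cauchyFrac_infty]
    | coe w =>
      rw [mem_compl_iff, coe_mem_image_coe, mem_closedBall, dist_zero_right, not_le] at hζ
      rw [cauchyFrac_coe, norm_div, norm_one]
      have h3 : 1 ≤ ‖z - w‖ := by
        have := norm_sub_norm_le w z
        rw [norm_sub_rev] at this
        linarith
      exact div_le_one_of_le₀ h3 (norm_nonneg _)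
  | coe z =>
    have h1 : (fun w : ℂ => (w : RSphere)) ⁻¹' S.pieces ∈ 𝓝 z :=
      (S.isOpen_pieces.preimage OnePoint.continuous_coe).mem_nhds hp
    obtain ⟨ε, hε, hb⟩ := Metric.mem_nhds_iff.1 h1
    have hδ : 0 < ε / 2 := by positivity
    refine ⟨(fun w : ℂ => (w : RSphere)) '' ball z (ε / 2),
      (OnePoint.isOpenMap_coe _ isOpen_ball).mem_nhds ⟨z, mem_ball_self hδ, rfl⟩, ?_,
      1 / (ε / 2), ?_⟩
    · rintro _ ⟨w, hw, rfl⟩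
      exact hb (ball_subset_ball (by linarith) hw)
    · rintro _ ⟨w, hw, rfl⟩ σ hσ l η hη
      refine norm_cauchyFrac_le hδ (fun h => ?_) hw
      rw [show 2 * (ε / 2) = ε by ring] at h
      exact finPart_apply_circle_notMem hσ hη (hb h)

theorem exists_bound {p : RSphere} (hp : p ∈ S.pieces) :
    ∃ B : ℝ, ∀ σ ∈ S.schottky, ∀ l : Fin n,
      ∀ η ∈ S.circle l, ‖cauchyFrac (finPart (σ (η : RSphere))) p‖ ≤ B := by
  obtain ⟨V, hV, -, B, hB⟩ := exists_nhds_bound hp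
  exact ⟨B, hB p (mem_of_mem_nhds hV)⟩

theorem notMem_image_circle_of_mem_pieces {p : RSphere} (hp : p ∈ S.pieces) (l : Fin n) :
    p ∉ (fun z : ℂ => (z : RSphere)) '' sphere (S.center l) (S.radius l) := by
  rintro ⟨η, hη, rfl⟩
  exact S.coe_circle_notMem_pieces hη hp

theorem continuousOn_cauchyFrac {z₀ : ℂ} {r : ℝ} {p : RSphere}
    (hp : p ∉ (fun z : ℂ => (z : RSphere)) '' sphere z₀ r) :
    ContinuousOn (fun η => cauchyFrac η p) (sphere z₀ r) := by
  induction p using OnePoint.rec with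
  | infty =>
    simp only [cauchyFrac_infty]
    exact continuousOn_const
  | coe z =>
    rw [coe_mem_image_coe] at hp
    simp only [cauchyFrac_coe]
    intro w hw
    have : w - z ≠ 0 := fun h => hp (by rwa [← sub_eq_zero.1 h])
    exact ContinuousAt.continuousWithinAt (by fun_prop (disch := assumption))

namespace MoebiusData

variable (D : S.MoebiusData) {ζs ζ : RSphere} (hζs : ζs ∈ S.pieces) (hζ : ζ ∈ S.pieces)
include D hζs hζ

theorem kernelTerm_eq_of_mem_pieces {l : Fin n} {η : ℂ} (hη : η ∈ S.circle l) (σ : S.schottky) :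
    S.kernelTerm ζs ζ η σ =
      cauchyFrac η ((σ⁻¹ : S.schottky).1 ζ) - cauchyFrac η ((σ⁻¹ : S.schottky).1 ζs) :=
  D.kernelTerm_eq hζs hη (apply_circle_ne_of_mem_pieces hζ σ.2 hη)

theorem exists_norm_kernelTerm_le : ∃ B : ℝ, ∀ (σ : S.schottky) (l : Fin n), ∀ η ∈ S.circle l,
    ‖S.kernelTerm ζs ζ η σ‖ ≤ B * D.bound σ := by
  obtain ⟨B, hB⟩ := exists_bound hζ
  obtain ⟨B', hB'⟩ := exists_bound hζs
  exact ⟨B + B', fun σ l η hη => D.norm_kernelTerm_le hη (hB σ σ.2 l η hη) (hB' σ σ.2 l η hη)⟩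

theorem summable_kernelTerm {l : Fin n} {η : ℂ} (hη : η ∈ S.circle l) :
    Summable (S.kernelTerm ζs ζ η) := by
  obtain ⟨B, hB⟩ := D.exists_norm_kernelTerm_le hζs hζ
  exact Summable.of_norm_bounded (D.summable.mul_left B) fun σ => hB σ l η hη

theorem continuousOn_kernelTerm (l : Fin n) (σ : S.schottky) :
    ContinuousOn (fun η => S.kernelTerm ζs ζ η σ) (S.circle l) := by
  have h1 : ContinuousOn (fun η => cauchyFrac η ((σ⁻¹ : S.schottky).1 ζ) -
      cauchyFrac η ((σ⁻¹ : S.schottky).1 ζs)) (S.circle l) :=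
    (continuousOn_cauchyFrac (notMem_image_circle_of_mem_pieces
      (S.schottky_apply_mem_pieces σ⁻¹.2 hζ) l)).sub
    (continuousOn_cauchyFrac (notMem_image_circle_of_mem_pieces
      (S.schottky_apply_mem_pieces σ⁻¹.2 hζs) l))
  exact h1.congr fun η hη => D.kernelTerm_eq_of_mem_pieces hζs hζ hη σ

theorem continuousOn_kernel (l : Fin n) : ContinuousOn (S.kernel ζs ζ) (S.circle l) := by
  obtain ⟨B, hB⟩ := D.exists_norm_kernelTerm_le hζs hζ
  exact continuousOn_tsum (D.continuousOn_kernelTerm hζs hζ l) (D.summable.mul_left B)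
    fun σ η hη => hB σ l η hη

theorem circleIntegrable_mul_kernel (l : Fin n) {g : ℂ → ℂ} (hg : ContinuousOn g (S.circle l)) :
    CircleIntegrable (fun η => g η * S.kernel ζs ζ η) (S.center l) (S.radius l) :=
  (hg.mul (D.continuousOn_kernel hζs hζ l)).circleIntegrable (S.radius_pos l).le

theorem kernel_eq_tsum {l : Fin n} {η : ℂ} (hη : η ∈ S.circle l) :
    HasSum (fun σ : S.schottky => cauchyFrac η (σ.1 ζ) - cauchyFrac η (σ.1 ζs))
      (S.kernel ζs ζ η) := by
  have h1 : HasSum (S.kernelTerm ζs ζ η) (S.kernel ζs ζ η) :=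
    (D.summable_kernelTerm hζs hζ hη).hasSum
  have e : (fun σ : S.schottky => cauchyFrac η (σ.1 ζ) - cauchyFrac η (σ.1 ζs)) =
      S.kernelTerm ζs ζ η ∘ Equiv.inv S.schottky := by
    ext σ
    rw [Function.comp_apply, Equiv.inv_apply, D.kernelTerm_eq_of_mem_pieces hζs hζ hη, inv_inv]
  rw [e]
  exact (Equiv.inv S.schottky).hasSum_iff.2 h1

/-- Subtracting the series for σ(ζ_*) from that for σ(ζ) removes the base point; what remains is the
series for ζ reindexed by right multiplication with σ. -/
theorem kernel_apply {σ : Equiv.Perm RSphere} (hσ : σ ∈ S.schottky) {l : Fin n} {η : ℂ}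
    (hη : η ∈ S.circle l) :
    S.kernel ζs (σ ζ) η = S.kernel ζs ζ η + S.chi ζs σ η := by
  have h1 := D.kernel_eq_tsum hζs (S.schottky_apply_mem_pieces hσ hζ) hη
  have h2 := D.kernel_eq_tsum hζs (S.schottky_apply_mem_pieces hσ hζs) hη
  have h3 := D.kernel_eq_tsum hζs hζ hη
  have h4 := (Equiv.mulRight (⟨σ, hσ⟩ : S.schottky)).hasSum_iff.2 h3
  have h5 := h1.sub h2
  simp only [sub_sub_sub_cancel_right] at h5
  have h6 := h5.unique h4
  rw [chi, ← h6]
  ring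

theorem hasSum_circleIntegral (l : Fin n) {g : ℂ → ℂ} (hg : ContinuousOn g (S.circle l)) :
    HasSum (fun σ : S.schottky => ∮ η in C(S.center l, S.radius l),
        g η * S.kernelTerm ζs ζ η σ)
      (∮ η in C(S.center l, S.radius l), g η * S.kernel ζs ζ η) := by
  -- Dominated convergence for series is used with a countable index set.
  have := S.countable_schottky
  obtain ⟨B, hB⟩ := D.exists_norm_kernelTerm_le hζs hζ
  obtain ⟨G, hG⟩ := (isCompact_sphere (S.center l) (S.radius l)).exists_bound_of_continuousOn hg
  have hr := (S.radius_pos l).le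
  have hmem : ∀ θ : ℝ, circleMap (S.center l) (S.radius l) θ ∈ S.circle l := fun θ =>
    circleMap_mem_sphere _ hr θ
  have hcont : ∀ {f : ℂ → ℂ}, ContinuousOn f (S.circle l) →
      Continuous fun θ : ℝ => f (circleMap (S.center l) (S.radius l) θ) := fun hf =>
    hf.comp_continuous (continuous_circleMap _ _) hmem
  refine intervalIntegral.hasSum_integral_of_dominated_convergence
    (fun σ _ => S.radius l * (G * (B * D.bound σ))) (fun σ => ?_) (fun σ => ?_) ?_ ?_ ?_
  · refine Continuous.aestronglyMeasurable ?_
    simp only [deriv_circleMap]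
    exact (by fun_prop : Continuous fun θ : ℝ => circleMap 0 (S.radius l) θ * Complex.I).smul
      (hcont (hg.mul (D.continuousOn_kernelTerm hζs hζ l σ)))
  · refine Eventually.of_forall fun θ _ => ?_
    have h1 := hG _ (hmem θ)
    have h2 := hB σ l _ (hmem θ)
    rw [norm_smul, deriv_circleMap, norm_mul, Complex.norm_I, mul_one, norm_circleMap_zero,
      abs_of_nonneg hr, norm_mul]
    exact mul_le_mul_of_nonneg_left (mul_le_mul h1 h2 (norm_nonneg _)
      ((norm_nonneg _).trans h1)) hr
  · exact Eventually.of_forall fun θ _ => ((D.summable.mul_left B).mul_left G).mul_left _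
  · exact intervalIntegrable_const
  · refine Eventually.of_forall fun θ _ => ?_
    exact ((D.summable_kernelTerm hζs hζ (hmem θ)).hasSum.mul_left _).const_smul _

end MoebiusData

open Classical in
/-- The winding number, times `2πi`, of the circle `𝔏_l` about a point. -/
theorem circleIntegral_cauchyFrac (l : Fin n) {p : RSphere} (hp : p ∈ S.pieces) :
    (∮ η in C(S.center l, S.radius l), cauchyFrac η p) =
      if p ∈ S.disc l then 2 * (Real.pi : ℂ) * Complex.I else 0 := by
  split_ifs with h
  · obtain ⟨z, hz, rfl⟩ := h
    exact circleIntegral_cauchyFrac_of_mem hz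
  · refine circleIntegral_cauchyFrac_of_notMem (S.radius_pos l).le ?_
    rintro ⟨z, hz, rfl⟩
    rcases (mem_closedBall.1 hz).lt_or_eq with h' | h'
    · exact h (coe_mem_image_coe.2 h')
    · exact S.coe_circle_notMem_pieces (l := l) h' hp

/-- Termwise, the integral compares the winding numbers of 𝔏_l about σ(σ_j(ζ_*)) and σ(ζ_*). They
agree except for σ = 1, where σ_j(ζ_*) lies in disc j and ζ_* in none, and for σ = σ_j⁻¹, where the
points are ζ_* and σ_j⁻¹(ζ_*), the latter in disc 0. -/
theorem MoebiusData.circleIntegral_chi (D : S.MoebiusData) {ζs : RSphere}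
    (hζs : ζs ∈ S.exterior) {j : Fin n} (hj : j ≠ 0) (l : Fin n) :
    (∮ η in C(S.center l, S.radius l), S.chi ζs (S.sigma j) η) =
      (if l = j then 2 * (Real.pi : ℂ) * Complex.I else 0) -
        if l = 0 then 2 * (Real.pi : ℂ) * Complex.I else 0 := by
  classical
  have hs := S.exterior_subset_pieces hζs
  have hσ := S.sigma_mem_schottky j
  have hσs := S.schottky_apply_mem_pieces hσ hs
  have h1 := D.hasSum_circleIntegral hs hσs l (continuousOn_const (c := (1 : ℂ)))
  simp only [one_mul] at h1
  set W : RSphere → ℂ := fun p => if p ∈ S.disc l then 2 * (Real.pi : ℂ) * Complex.I else 0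
    with hW
  have h2 : ∀ σ : S.schottky, (∮ η in C(S.center l, S.radius l),
      S.kernelTerm ζs (S.sigma j ζs) η σ) =
      W ((σ⁻¹ : S.schottky).1 (S.sigma j ζs)) - W ((σ⁻¹ : S.schottky).1 ζs) := by
    intro σ
    have m1 := S.schottky_apply_mem_pieces σ⁻¹.2 hσs
    have m2 := S.schottky_apply_mem_pieces σ⁻¹.2 hs
    rw [circleIntegral.integral_congr (S.radius_pos l).le
      fun η hη => D.kernelTerm_eq_of_mem_pieces hs hσs (l := l) hη σ,
      circleIntegral.integral_sub, circleIntegral_cauchyFrac l m1, circleIntegral_cauchyFrac l m2]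
    · exact (continuousOn_cauchyFrac
        (notMem_image_circle_of_mem_pieces m1 l)).circleIntegrable (S.radius_pos l).le
    · exact (continuousOn_cauchyFrac
        (notMem_image_circle_of_mem_pieces m2 l)).circleIntegrable (S.radius_pos l).le
  simp only [h2] at h1
  have h3 := (Equiv.inv S.schottky).hasSum_iff.2 h1
  simp only [Function.comp_def, Equiv.inv_apply, inv_inv] at h3
  set τ : S.schottky := (⟨S.sigma j, hσ⟩ : S.schottky)⁻¹ with hτ
  have hdisc : ∀ {p : RSphere} {a : Fin n}, p ∈ S.disc a →
      W p = if l = a then 2 * (Real.pi : ℂ) * Complex.I else 0 := by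
    intro p a hp
    simp only [hW]
    by_cases h : l = a
    · subst h
      simp [hp]
    · rw [if_neg h, if_neg]
      exact fun h' => h (S.eq_of_mem_closedDisc (S.disc_subset_closedDisc _ h')
        (S.disc_subset_closedDisc _ hp))
  have hext : W ζs = 0 := by
    simp only [hW]
    exact if_neg fun h => S.mem_exterior_iff.1 hζs l (S.disc_subset_closedDisc _ h)
  have hne : (1 : S.schottky) ≠ τ := by
    intro e
    have e1 : (S.sigma j)⁻¹ ζs = ζs :=
      (congrArg (fun σ : S.schottky => σ.1 ζs) e).symm
    have h4 := S.sigma_inv_apply_mem_disc hj hζs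
    exact S.mem_exterior_iff.1 hζs 0 (S.disc_subset_closedDisc _ (e1 ▸ h4))
  have h5 : HasSum (fun σ : S.schottky => W (σ.1 (S.sigma j ζs)) - W (σ.1 ζs))
      (∑ σ ∈ ({1, τ} : Finset S.schottky), (W (σ.1 (S.sigma j ζs)) - W (σ.1 ζs))) := by
    refine hasSum_sum_of_ne_finset_zero fun σ hσ' => ?_
    simp only [Finset.mem_insert, Finset.mem_singleton, not_or] at hσ'
    obtain ⟨a, ha, hb⟩ := S.exists_disc_of_ne hζs σ.2 (fun e => hσ'.1 (Subtype.ext e))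
      (fun e => hσ'.2 (Subtype.ext e)) hj
    rw [hdisc ha, hdisc hb, sub_self]
  have h6 := h3.unique h5
  rw [Finset.sum_pair hne] at h6
  have e1 : ((1 : S.schottky) : Equiv.Perm RSphere) (S.sigma j ζs) = S.sigma j ζs := rfl
  have e2 : ((1 : S.schottky) : Equiv.Perm RSphere) ζs = ζs := rfl
  have e3 : τ.1 (S.sigma j ζs) = ζs := (S.sigma j).symm_apply_apply _
  have e4 : τ.1 ζs = (S.sigma j)⁻¹ ζs := rfl
  rw [e1, e2, e3, e4, hext, hdisc (S.sigma_apply_mem_disc hj hζs),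
    hdisc (S.sigma_inv_apply_mem_disc hj hζs)] at h6
  simp only [chi]
  rw [h6]
  ring

end CircleSystem

/-! ### The functions Ψ₁ and Φ₁: analyticity, automorphy and jumps. -/

theorem AnalyticAt.comp_conj_conj {f : ℂ → ℂ} {z : ℂ} (hf : AnalyticAt ℂ f (conj z)) :
    AnalyticAt ℂ (fun w => conj (f (conj w))) z := by
  rw [Complex.analyticAt_iff_eventually_differentiableAt] at hf ⊢
  filter_upwards [Complex.continuous_conj.continuousAt.eventually hf] with w hw
  have := hw.conj_conj
  rwa [Complex.conj_conj] at this

namespace CircleSystem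

open Set Filter Metric

variable {n : ℕ} (S : CircleSystem n)

/-- The sum of the Cauchy transforms of the functions `Im (c η) - a_l` on the circles. -/
def cauchyTransform (c : ℂ) (a : Fin n → ℝ) (p : RSphere) : ℂ :=
  ∑ l, imTransform c (a l) (S.center l) (S.radius l) p

theorem differentiableAt_cauchyTransform_smul (c : ℂ) (a : Fin n → ℝ) (N : GL (Fin 2) ℂ) {w : ℂ}
    (hw : ∀ l, ∀ η ∈ S.circle l, N • (w : RSphere) ≠ (η : RSphere)) :
    DifferentiableAt ℂ (fun z : ℂ => S.cauchyTransform c a (N • (z : RSphere))) w := by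
  unfold cauchyTransform
  refine DifferentiableAt.fun_sum fun l _ => ?_
  refine differentiableAt_imTransform_smul (S.radius_pos l) N ?_
  rintro ⟨η, hη, e⟩
  exact hw l η hη e.symm

theorem continuous_density (c : ℂ) (a : ℝ) :
    Continuous fun η : ℂ => (((c * η).im - a : ℝ) : ℂ) :=
  Complex.continuous_ofReal.comp
    ((Complex.continuous_im.comp (continuous_const.mul continuous_id)).sub continuous_const)

theorem T_notMem_closedDisc {j : Fin n} {p : RSphere} (hp : p ∈ S.disc j) :
    S.T j p ∉ S.closedDisc j := by
  obtain ⟨z, hz, rfl⟩ := hp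
  by_cases h : z = S.center j
  · have : S.T j (z : RSphere) = ∞ := by simp [T_apply, circleReflection, h]
    simp only [this]
    exact infty_notMem_image_coe
  · have hr := S.radius_pos j
    have h0 : 0 < dist z (S.center j) := dist_pos.2 h
    simp only
    rw [S.T_coe_of_ne h, closedDisc, coe_mem_image_coe, mem_closedBall, not_le, dist_eq_norm,
      add_sub_cancel_left, norm_div, ← map_sub, RCLike.norm_conj, norm_pow, Complex.norm_real,
      Real.norm_of_nonneg hr.le, ← dist_eq_norm, lt_div_iff₀ h0]
    have := mem_ball.1 hz
    nlinarith

theorem tendsto_T_of_mem_circle {j : Fin n} {ξ : ℂ} (hξ : ξ ∈ S.circle j) :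
    Tendsto (fun z : ℂ => S.T j (z : RSphere)) (𝓝 ξ) (𝓝 (ξ : RSphere)) := by
  have h1 : ContinuousAt (fun z : ℂ => S.T j (z : RSphere)) ξ :=
    ((S.continuous_T j).comp OnePoint.continuous_coe).continuousAt
  have h2 := h1.tendsto
  rwa [S.T_coe_of_mem_circle hξ] at h2

theorem eventually_mem_exterior {j : Fin n} {ξ : ℂ} (hξ : ξ ∈ S.circle j) :
    ∀ᶠ p in 𝓝 (ξ : RSphere), p ∉ S.closedDisc j → p ∈ S.exterior := by
  have h1 : ∀ l, ∀ᶠ p in 𝓝 (ξ : RSphere), l ≠ j → p ∉ S.closedDisc l := by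
    intro l
    by_cases h : l = j
    · exact Eventually.of_forall fun p h' => absurd h h'
    · have : (ξ : RSphere) ∉ S.closedDisc l := fun h' =>
        h (S.eq_of_mem_closedDisc h' (S.coe_mem_closedDisc_of_mem_circle hξ))
      filter_upwards [(isClosed_image_closedBall _ _).isOpen_compl.mem_nhds this] with p hp _
      exact hp
  filter_upwards [eventually_all.2 h1] with p hp hj
  refine S.mem_exterior_iff.2 fun l => ?_
  by_cases h : l = j
  · rwa [h]
  · exact hp l h

theorem tendsto_exterior_iff {j : Fin n} {ξ : ℂ} {Φ : RSphere → ℂ} {l : Filter ℂ} :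
    Tendsto (fun z : ℂ => Φ (z : RSphere))
      (𝓝[(closedBall (S.center j) (S.radius j))ᶜ] ξ) l ↔
      Tendsto Φ (𝓝[(S.closedDisc j)ᶜ] (ξ : RSphere)) l := by
  rw [OnePoint.nhdsWithin_coe, tendsto_map'_iff, closedDisc, preimage_compl,
    preimage_image_eq _ OnePoint.coe_injective]
  rfl

theorem tendsto_interior_iff {j : Fin n} {ξ : ℂ} {Φ : RSphere → ℂ} {l : Filter ℂ} :
    Tendsto (fun z : ℂ => Φ (z : RSphere)) (𝓝[ball (S.center j) (S.radius j)] ξ) l ↔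
      Tendsto Φ (𝓝[S.disc j] (ξ : RSphere)) l := by
  rw [OnePoint.nhdsWithin_coe, tendsto_map'_iff, disc, preimage_image_eq _ OnePoint.coe_injective]
  rfl

theorem tendsto_T_exterior {j : Fin n} {ξ : ℂ} (hξ : ξ ∈ S.circle j) :
    Tendsto (S.T j) (𝓝[(S.closedDisc j)ᶜ] (ξ : RSphere)) (𝓝[S.disc j] (ξ : RSphere)) := by
  have h1 := (S.continuous_T j).tendsto (ξ : RSphere)
  rw [S.T_coe_of_mem_circle hξ] at h1
  exact tendsto_nhdsWithin_of_tendsto_nhds_of_eventually_within _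
    (h1.mono_left nhdsWithin_le_nhds)
    (by filter_upwards [self_mem_nhdsWithin] with p hp using S.T_mem_disc hp)

theorem tendsto_T_interior {j : Fin n} {ξ : ℂ} (hξ : ξ ∈ S.circle j) :
    Tendsto (S.T j) (𝓝[S.disc j] (ξ : RSphere)) (𝓝[(S.closedDisc j)ᶜ] (ξ : RSphere)) := by
  have h1 := (S.continuous_T j).tendsto (ξ : RSphere)
  rw [S.T_coe_of_mem_circle hξ] at h1
  exact tendsto_nhdsWithin_of_tendsto_nhds_of_eventually_within _
    (h1.mono_left nhdsWithin_le_nhds)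
    (by filter_upwards [self_mem_nhdsWithin] with p hp using S.T_notMem_closedDisc hp)

variable [NeZero n]

/-- The contribution of `σ` to `2π Ψ₁(ζ)`. -/
def psiTerm (ζs : RSphere) (c : ℂ) (a : Fin n → ℝ) (ζ : RSphere) (σ : S.schottky) : ℂ :=
  ∑ l, ∮ η in C(S.center l, S.radius l),
    (((c * η).im - a l : ℝ) : ℂ) * S.kernelTerm ζs ζ η σ

variable {S}

theorem inv_apply_ne_of_ne {σ : S.schottky} {ζ : RSphere} {η : ℂ}
    (h : ζ ≠ (σ : Equiv.Perm RSphere) (η : RSphere)) :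
    (σ⁻¹ : S.schottky).1 ζ ≠ (η : RSphere) := fun e =>
  h (by rw [← e]; exact ((σ : Equiv.Perm RSphere).apply_symm_apply _).symm)

namespace MoebiusData

variable (D : S.MoebiusData) {ζs ζ : RSphere} (hζs : ζs ∈ S.pieces) (c : ℂ) (a : Fin n → ℝ)

include D hζs

theorem psiTerm_eq {σ : S.schottky}
    (hζ : ∀ l, ∀ η ∈ S.circle l, ζ ≠ (σ : Equiv.Perm RSphere) (η : RSphere)) :
    S.psiTerm ζs c a ζ σ = S.cauchyTransform c a ((σ⁻¹ : S.schottky).1 ζ) -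
      S.cauchyTransform c a ((σ⁻¹ : S.schottky).1 ζs) := by
  rw [psiTerm, cauchyTransform, cauchyTransform, ← Finset.sum_sub_distrib]
  refine Finset.sum_congr rfl fun l _ => ?_
  have hr := (S.radius_pos l).le
  have hc := (continuous_density c (a l)).continuousOn (s := sphere (S.center l) (S.radius l))
  rw [imTransform, imTransform, ← circleIntegral.integral_sub]
  · refine circleIntegral.integral_congr hr fun η hη => ?_
    rw [D.kernelTerm_eq hζs (l := l) hη (hζ l η hη), mul_sub]
  · refine circleIntegrable_cauchyFrac hr ?_ hc
    rintro ⟨η, hη, e⟩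
    exact inv_apply_ne_of_ne (hζ l η hη) e.symm
  · exact circleIntegrable_cauchyFrac hr (notMem_image_circle_of_mem_pieces
      (S.schottky_apply_mem_pieces σ⁻¹.2 hζs) l) hc

/-- The constant depends on ζ only through `B`, which gives locally uniform bounds; ζ itself need
not lie in the pieces. -/
theorem exists_norm_psiTerm_le : ∃ C : ℝ → ℝ, ∀ (B : ℝ) (ζ : RSphere) (σ : S.schottky),
    (∀ l, ∀ η ∈ S.circle l, ‖cauchyFrac (finPart ((σ : Equiv.Perm RSphere) η)) ζ‖ ≤ B) →
    ‖S.psiTerm ζs c a ζ σ‖ ≤ C B * D.bound σ := by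
  obtain ⟨B', hB'⟩ := exists_bound hζs
  have hG : ∀ l, ∃ G : ℝ, ∀ η ∈ sphere (S.center l) (S.radius l),
      ‖(((c * η).im - a l : ℝ) : ℂ)‖ ≤ G := fun l =>
    (isCompact_sphere _ _).exists_bound_of_continuousOn (continuous_density c (a l)).continuousOn
  choose G hG using hG
  refine ⟨fun B => ∑ l, 2 * Real.pi * S.radius l * (G l * (B + B')), fun B ζ σ hB => ?_⟩
  rw [Finset.sum_mul]
  refine (norm_sum_le _ _).trans (Finset.sum_le_sum fun l _ => ?_)
  rw [mul_assoc (2 * Real.pi * S.radius l), mul_assoc (G l)]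
  refine circleIntegral.norm_integral_le_of_norm_le_const (S.radius_pos l).le fun η hη => ?_
  rw [norm_mul]
  exact mul_le_mul (hG l η hη) (D.norm_kernelTerm_le (l := l) hη (hB l η hη) (hB' σ σ.2 l η hη))
    (norm_nonneg _) ((norm_nonneg _).trans (hG l η hη))

theorem hasSum_psiTerm (hζ : ζ ∈ S.pieces) :
    HasSum (S.psiTerm ζs c a ζ) (2 * (Real.pi : ℂ) * S.Psi1 ζs c a ζ) := by
  have h1 := hasSum_sum fun l (_ : l ∈ Finset.univ) => D.hasSum_circleIntegral hζs hζ l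
    (continuous_density c (a l)).continuousOn
  have hpi : (2 * (Real.pi : ℂ)) ≠ 0 := by
    simp [Real.pi_ne_zero]
  rw [Psi1, ← mul_assoc, mul_one_div_cancel hpi, one_mul]
  exact h1

theorem Psi1_eq_tsum (hζ : ζ ∈ S.pieces) :
    S.Psi1 ζs c a ζ = 1 / (2 * (Real.pi : ℂ)) * ∑' σ, S.psiTerm ζs c a ζ σ := by
  have hpi : (2 * (Real.pi : ℂ)) ≠ 0 := by
    simp [Real.pi_ne_zero]
  rw [(D.hasSum_psiTerm hζs c a hζ).tsum_eq, ← mul_assoc, one_div_mul_cancel hpi, one_mul]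

/-- A locally uniformly convergent series of analytic terms. The coordinate `N` later serves as the
identity, the inversion, or the matrix of a reflection. -/
theorem analyticAt_Psi1_smul (N : GL (Fin 2) ℂ) {w : ℂ} (hw : N • (w : RSphere) ∈ S.pieces) :
    AnalyticAt ℂ (fun z : ℂ => S.Psi1 ζs c a (N • (z : RSphere))) w := by
  obtain ⟨V, hV, hVs, B, hB⟩ := exists_nhds_bound hw
  obtain ⟨C, hC⟩ := D.exists_norm_psiTerm_le hζs c a
  set U : Set ℂ := (fun z : ℂ => N • (z : RSphere)) ⁻¹' interior V with hU
  have hUo : IsOpen U := isOpen_interior.preimage (continuous_smul_coe N)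
  have hUV : ∀ z ∈ U, N • (z : RSphere) ∈ V := fun z hz => interior_subset hz
  have hwU : w ∈ U := mem_interior_iff_mem_nhds.2 hV
  have h1 : DifferentiableOn ℂ
      (fun z : ℂ => ∑' σ, S.psiTerm ζs c a (N • (z : RSphere)) σ) U := by
    refine Complex.differentiableOn_tsum_of_summable_norm (D.summable.mul_left (C B)) (fun σ => ?_) hUo
      fun σ z hz => hC B _ σ fun l η hη => hB _ (hUV z hz) σ σ.2 l η hη
    have h2 : DifferentiableOn ℂ (fun z : ℂ => S.cauchyTransform c a
        ((D.matrix σ⁻¹ * N) • (z : RSphere)) -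
          S.cauchyTransform c a ((σ⁻¹ : S.schottky).1 ζs)) U := by
      intro z hz
      refine DifferentiableAt.differentiableWithinAt
        ((S.differentiableAt_cauchyTransform_smul c a _ fun l η hη => ?_).sub_const _)
      rw [mul_smul, ← D.apply_eq]
      exact inv_apply_ne_of_ne (apply_circle_ne_of_mem_pieces (hVs (hUV z hz)) σ.2 hη)
    refine h2.congr fun z hz => ?_
    rw [D.psiTerm_eq hζs c a fun l η hη =>
      apply_circle_ne_of_mem_pieces (hVs (hUV z hz)) σ.2 hη, mul_smul, ← D.apply_eq]
  refine DifferentiableOn.analyticAt ?_ (hUo.mem_nhds hwU)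
  refine (h1.const_mul (1 / (2 * (Real.pi : ℂ)))).congr fun z hz => ?_
  rw [D.Psi1_eq_tsum hζs c a (hVs (hUV z hz))]

theorem Psi1_apply (hζ : ζ ∈ S.pieces) {σ : Equiv.Perm RSphere} (hσ : σ ∈ S.schottky) :
    S.Psi1 ζs c a (σ ζ) = S.Psi1 ζs c a ζ + S.Psi1 ζs c a (σ ζs) := by
  rw [Psi1, Psi1, Psi1, ← mul_add, ← Finset.sum_add_distrib]
  congr 1
  refine Finset.sum_congr rfl fun l _ => ?_
  have hc := (continuous_density c (a l)).continuousOn (s := S.circle l)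
  rw [← circleIntegral.integral_add (D.circleIntegrable_mul_kernel hζs hζ l hc)
    (D.circleIntegrable_mul_kernel hζs (S.schottky_apply_mem_pieces hσ hζs) l hc)]
  refine circleIntegral.integral_congr (S.radius_pos l).le fun η hη => ?_
  rw [D.kernel_apply hζs hζ hσ (l := l) hη, chi, mul_add]

theorem Psi1_inv_apply (hζ : ζ ∈ S.pieces) {σ : Equiv.Perm RSphere} (hσ : σ ∈ S.schottky) :
    S.Psi1 ζs c a (σ⁻¹ ζ) = S.Psi1 ζs c a ζ - S.Psi1 ζs c a (σ ζs) := by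
  have h1 := D.Psi1_apply hζs c a (S.schottky_apply_mem_pieces (inv_mem hσ) hζ) hσ
  rw [show σ (σ⁻¹ ζ) = ζ from σ.apply_symm_apply ζ] at h1
  rw [h1]
  ring

/-- Since T_0 σ_j = σ_j⁻¹ T_0, the first summand gains the constant Ψ₁(σ_j(ζ_*)) and the second
loses its conjugate. -/
theorem Phi1_sigma_apply (C₁ : ℝ) (hζ : ζ ∈ S.pieces) (j : Fin n) :
    S.Phi1 ζs c a C₁ (S.sigma j ζ) =
      S.Phi1 ζs c a C₁ ζ + 2 * Complex.I * (S.Psi1 ζs c a (S.sigma j ζs)).im := by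
  have e : S.T 0 (S.sigma j ζ) = (S.sigma j)⁻¹ (S.T 0 ζ) := by
    rw [sigma_inv, sigma]
    rfl
  rw [Phi1, Phi1, e, D.Psi1_inv_apply hζs c a (S.T_mem_pieces 0 hζ) (S.sigma_mem_schottky j),
    D.Psi1_apply hζs c a hζ (S.sigma_mem_schottky j), map_sub]
  have := Complex.sub_conj (S.Psi1 ζs c a (S.sigma j ζs))
  push_cast at this
  linear_combination this

omit hζs in
theorem im_Psi1_sigma (hζs : ζs ∈ S.exterior) {j : Fin n} (hj : j ≠ 0) :
    (S.Psi1 ζs c a (S.sigma j ζs)).im = 1 / (2 * Real.pi) *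
      (∑ l, ∮ η in C(S.center l, S.radius l),
        (((c * η).im : ℝ) : ℂ) * S.chi ζs (S.sigma j) η).im - (a j - a 0) := by
  have hs := S.exterior_subset_pieces hζs
  have hσs := S.schottky_apply_mem_pieces (S.sigma_mem_schottky j) hs
  have h1 : ∀ l, (∮ η in C(S.center l, S.radius l),
      (((c * η).im - a l : ℝ) : ℂ) * S.kernel ζs (S.sigma j ζs) η) =
      (∮ η in C(S.center l, S.radius l), (((c * η).im : ℝ) : ℂ) * S.chi ζs (S.sigma j) η) -
        a l * ((if l = j then 2 * (Real.pi : ℂ) * Complex.I else 0) -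
          if l = 0 then 2 * (Real.pi : ℂ) * Complex.I else 0) := by
    intro l
    have hc := (continuous_density c 0).continuousOn (s := S.circle l)
    simp only [sub_zero] at hc
    rw [← D.circleIntegral_chi hζs hj l, ← circleIntegral.integral_const_mul,
      ← circleIntegral.integral_sub]
    · congr 1
      ext η
      rw [chi]
      push_cast
      ring
    · exact D.circleIntegrable_mul_kernel hs hσs l hc
    · exact D.circleIntegrable_mul_kernel hs hσs l continuousOn_const
  rw [Psi1, Finset.sum_congr rfl fun l _ => h1 l, Finset.sum_sub_distrib]
  -- The integrals of χ select just a_j and a_0 from the constants in the density.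
  have h2 : (∑ l, (a l : ℂ) * ((if l = j then 2 * (Real.pi : ℂ) * Complex.I else 0) -
          if l = 0 then 2 * (Real.pi : ℂ) * Complex.I else 0)) =
      2 * Real.pi * Complex.I * (a j - a 0) := by
    simp only [mul_sub, mul_ite, mul_zero, Finset.sum_sub_distrib, Finset.sum_ite_eq',
      Finset.mem_univ, if_true]
    ring
  rw [h2, mul_sub, Complex.sub_im]
  have h3 : (1 / (2 * (Real.pi : ℂ))) = ((1 / (2 * Real.pi) : ℝ) : ℂ) := by push_cast; rfl
  have h4 : 2 * (Real.pi : ℂ) * Complex.I * (a j - a 0) =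
      ((2 * Real.pi * (a j - a 0) : ℝ) : ℂ) * Complex.I := by
    push_cast
    ring
  rw [h3, h4, Complex.im_ofReal_mul, Complex.im_ofReal_mul, Complex.im_ofReal_mul,
    Complex.I_im]
  have := Real.pi_ne_zero
  field_simp

omit D hζs in
theorem isAutomorphic_of_sigma {Φ : RSphere → ℂ}
    (h : ∀ j, j ≠ 0 → ∀ ζ ∈ S.pieces, Φ (S.sigma j ζ) = Φ ζ) : S.IsAutomorphic Φ := by
  intro σ hσ
  induction hσ using Subgroup.closure_induction with
  | mem x hx =>
    obtain ⟨j, rfl⟩ := hx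
    by_cases hj : j = 0
    · subst hj
      intro ζ _
      rw [sigma, T_mul_self, Equiv.Perm.one_apply]
    · exact h j hj
  | one => exact fun ζ _ => rfl
  | mul x y hx hy ihx ihy =>
    intro ζ hζ
    rw [Equiv.Perm.mul_apply, ihx _ (S.schottky_apply_mem_pieces hy hζ), ihy _ hζ]
  | inv x hx ihx =>
    intro ζ hζ
    rw [← ihx _ (S.schottky_apply_mem_pieces (inv_mem hx) hζ)]
    exact congrArg Φ (x.apply_symm_apply ζ)

omit hζs in
theorem isAutomorphic_Phi1_iff (hζs : ζs ∈ S.exterior) (C₁ : ℝ) :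
    S.IsAutomorphic (S.Phi1 ζs c a C₁) ↔ S.ConstantsFormula ζs c a := by
  have hs := S.exterior_subset_pieces hζs
  constructor
  · intro h j hj
    have h1 := h _ (S.sigma_mem_schottky j) ζs hs
    rw [D.Phi1_sigma_apply hs c a C₁ hs, add_eq_left, D.im_Psi1_sigma c a hζs hj] at h1
    have h2 := (mul_eq_zero.1 h1).resolve_left (by simp)
    rw [Complex.ofReal_eq_zero] at h2
    linarith
  · intro h
    refine isAutomorphic_of_sigma fun j hj ζ hζ => ?_
    rw [D.Phi1_sigma_apply hs c a C₁ hζ, D.im_Psi1_sigma c a hζs hj, h j hj]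
    simp

end MoebiusData

/-- Close to ξ, points outside the circle are in the exterior, and points inside are `T j`-images of
exterior points. -/
theorem eventually_mem_pieces (S : CircleSystem n) {j : Fin n} {ξ : ℂ} (hξ : ξ ∈ S.circle j) :
    ∀ᶠ z : ℂ in 𝓝 ξ, (z : RSphere) ∈ S.pieces ∨ z ∈ S.circle j := by
  have h1 := (OnePoint.continuous_coe.tendsto ξ).eventually (S.eventually_mem_exterior hξ)
  have h2 := (S.tendsto_T_of_mem_circle hξ).eventually (S.eventually_mem_exterior hξ)
  filter_upwards [h1, h2] with z hz1 hz2
  rcases lt_trichotomy (dist z (S.center j)) (S.radius j) with h | h | h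
  · left
    have h3 := hz2 (S.T_notMem_closedDisc (coe_mem_image_coe.2 h))
    have h4 := S.T_mem_pieces j (S.exterior_subset_pieces h3)
    rwa [T_T] at h4
  · exact Or.inr h
  · left
    refine S.exterior_subset_pieces (hz1 ?_)
    rw [closedDisc, coe_mem_image_coe]
    exact not_le.2 h

namespace MoebiusData

variable (D : S.MoebiusData) {ζs : RSphere} (hζs : ζs ∈ S.pieces) (c : ℂ) (a : Fin n → ℝ)
include D hζs

/-- Near a point of the circle, `2π Ψ₁` differs from the Cauchy transform by a continuous
function. -/
theorem exists_continuousAt_Psi1_sub {j : Fin n} {ξ : ℂ} (hξ : ξ ∈ S.circle j) :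
    ∃ R : ℂ → ℂ, ContinuousAt R ξ ∧ ∀ᶠ z : ℂ in 𝓝 ξ, (z : RSphere) ∈ S.pieces →
      S.Psi1 ζs c a (z : RSphere) =
        1 / (2 * (Real.pi : ℂ)) * (S.cauchyTransform c a (z : RSphere) + R z) := by
  classical
  obtain ⟨ε, hε, hb⟩ := Metric.mem_nhds_iff.1 (S.eventually_mem_pieces hξ)
  obtain ⟨C, hC⟩ := D.exists_norm_psiTerm_le hζs c a
  have hδ : 0 < ε / 2 := by positivity
  -- The ball consists of pieces and points of 𝔏_j; for σ ≠ 1 the images of the circles meet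
  -- neither.
  have havoid : ∀ σ : S.schottky, σ ≠ 1 → ∀ l, ∀ η ∈ S.circle l,
      finPart ((σ : Equiv.Perm RSphere) η) ∉ ball ξ ε := by
    intro σ h1 l η hη h
    have h1' : (σ : Equiv.Perm RSphere) ≠ 1 := fun e => h1 (Subtype.ext e)
    rcases hb h with h | h
    · exact finPart_apply_circle_notMem σ.2 hη h
    · refine S.schottky_apply_circle_ne σ.2 h1' hη h ?_
      rw [coe_finPart (S.schottky_apply_circle_ne_infty σ.2 hη)]
  have hne : ∀ σ : S.schottky, σ ≠ 1 → ∀ z ∈ ball ξ ε, ∀ l, ∀ η ∈ S.circle l,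
      (z : RSphere) ≠ (σ : Equiv.Perm RSphere) (η : RSphere) := by
    intro σ h1 z hz l η hη e
    have := havoid σ h1 l η hη
    rw [← e, finPart_coe] at this
    exact this hz
  set R : ℂ → ℂ := fun z => ∑' σ : S.schottky, ite (σ = 1) 0 (S.psiTerm ζs c a (z : RSphere) σ)
    with hR
  have hbound : ∀ (σ : S.schottky) (z : ℂ), z ∈ ball ξ (ε / 2) →
      ‖ite (σ = 1) 0 (S.psiTerm ζs c a (z : RSphere) σ)‖ ≤ ‖C (1 / (ε / 2))‖ * D.bound σ := by
    intro σ z hz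
    by_cases h : σ = 1
    · rw [if_pos h, norm_zero]
      exact mul_nonneg (norm_nonneg _) (D.bound_nonneg σ)
    · rw [if_neg h]
      refine (hC (1 / (ε / 2)) _ σ fun l η hη => ?_).trans
        (mul_le_mul_of_nonneg_right (le_abs_self _) (D.bound_nonneg σ))
      refine norm_cauchyFrac_le hδ ?_ hz
      rw [show 2 * (ε / 2) = ε by ring]
      exact havoid σ h l η hη
  have hcont : ∀ σ : S.schottky,
      ContinuousOn (fun z : ℂ => ite (σ = 1) 0 (S.psiTerm ζs c a (z : RSphere) σ))
        (ball ξ (ε / 2)) := by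
    intro σ
    by_cases h : σ = 1
    · simp only [if_pos h]
      exact continuousOn_const
    · simp only [if_neg h]
      have h2 : ContinuousOn (fun z : ℂ => S.cauchyTransform c a
          (D.matrix σ⁻¹ • (z : RSphere)) -
            S.cauchyTransform c a ((σ⁻¹ : S.schottky).1 ζs)) (ball ξ (ε / 2)) := by
        intro z hz
        have hz' : z ∈ ball ξ ε := ball_subset_ball (by linarith) hz
        refine ContinuousAt.continuousWithinAt (DifferentiableAt.continuousAt (𝕜 := ℂ)
          ((S.differentiableAt_cauchyTransform_smul c a _ fun l η hη => ?_).sub_const _))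
        rw [← D.apply_eq]
        exact inv_apply_ne_of_ne (hne σ h z hz' l η hη)
      refine h2.congr fun z hz => ?_
      have hz' : z ∈ ball ξ ε := ball_subset_ball (by linarith) hz
      simp only
      rw [D.psiTerm_eq hζs c a (hne σ h z hz'), ← D.apply_eq]
  have hRc : ContinuousOn R (ball ξ (ε / 2)) :=
    continuousOn_tsum hcont (D.summable.mul_left _) hbound
  -- The subtracted constant is the base-point part of the term σ = 1.
  refine ⟨fun z => R z - S.cauchyTransform c a ζs,
    (hRc.continuousAt (isOpen_ball.mem_nhds (mem_ball_self hδ))).sub continuousAt_const, ?_⟩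
  filter_upwards with z hz
  rw [D.Psi1_eq_tsum hζs c a hz,
    (D.hasSum_psiTerm hζs c a hz).summable.tsum_eq_add_tsum_ite (1 : S.schottky),
    D.psiTerm_eq hζs c a fun l η hη => apply_circle_ne_of_mem_pieces hz (one_mem _) hη]
  have e1 : ((1⁻¹ : S.schottky) : Equiv.Perm RSphere) = 1 := by simp
  rw [e1, Equiv.Perm.one_apply, Equiv.Perm.one_apply]
  simp only [hR]
  ring

theorem Psi1_jump {j : Fin n} {ξ : ℂ} (hξ : ξ ∈ S.circle j) :
    ∃ P M : ℂ, Tendsto (S.Psi1 ζs c a) (𝓝[S.disc j] (ξ : RSphere)) (𝓝 P) ∧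
      Tendsto (S.Psi1 ζs c a) (𝓝[(S.closedDisc j)ᶜ] (ξ : RSphere)) (𝓝 M) ∧
      P - M = Complex.I * (((c * ξ).im - a j : ℝ) : ℂ) := by
  obtain ⟨R, hR, hRe⟩ := D.exists_continuousAt_Psi1_sub hζs c a hξ
  obtain ⟨P, M, hP, hM, hPM⟩ := imTransform_jump (c := c) (a := a j) (S.radius_pos j) hξ
  set Q : ℂ → ℂ := fun z =>
    ∑ l ∈ Finset.univ.erase j, imTransform c (a l) (S.center l) (S.radius l) (z : RSphere) with hQ
  have hQc : ContinuousAt Q ξ := by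
    refine DifferentiableAt.continuousAt (𝕜 := ℂ) (DifferentiableAt.fun_sum fun l hl => ?_)
    have := differentiableAt_imTransform_smul (c := c) (a := a l) (S.radius_pos l) 1 (w := ξ)
      (z₀ := S.center l) (by
        rw [one_smul]
        rintro ⟨η, hη, e⟩
        refine (Finset.mem_erase.1 hl).1 ?_
        rw [OnePoint.coe_injective e] at hη
        exact S.eq_of_mem_closedDisc (S.coe_mem_closedDisc_of_mem_circle (j := l) hη)
          (S.coe_mem_closedDisc_of_mem_circle hξ))
    simpa only [one_smul] using this
  have hsplit : ∀ᶠ z : ℂ in 𝓝 ξ, z ∉ S.circle j → S.Psi1 ζs c a (z : RSphere) =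
      1 / (2 * (Real.pi : ℂ)) *
        (imTransform c (a j) (S.center j) (S.radius j) (z : RSphere) + Q z + R z) := by
    filter_upwards [hRe, S.eventually_mem_pieces hξ] with z hz1 hz2 hz3
    rw [hz1 (hz2.resolve_right hz3), cauchyTransform,
      ← Finset.add_sum_erase Finset.univ _ (Finset.mem_univ j)]
  refine ⟨1 / (2 * (Real.pi : ℂ)) * (P + Q ξ + R ξ), 1 / (2 * (Real.pi : ℂ)) * (M + Q ξ + R ξ),
    S.tendsto_interior_iff.1 ?_, S.tendsto_exterior_iff.1 ?_, ?_⟩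
  · refine (((hP.add (hQc.tendsto.mono_left nhdsWithin_le_nhds)).add
      (hR.tendsto.mono_left nhdsWithin_le_nhds)).const_mul _).congr' ?_
    filter_upwards [nhdsWithin_le_nhds hsplit, self_mem_nhdsWithin] with z hz hz'
    exact (hz fun h => (mem_ball.1 hz').ne h).symm
  · refine (((hM.add (hQc.tendsto.mono_left nhdsWithin_le_nhds)).add
      (hR.tendsto.mono_left nhdsWithin_le_nhds)).const_mul _).congr' ?_
    filter_upwards [nhdsWithin_le_nhds hsplit, self_mem_nhdsWithin] with z hz hz'
    exact (hz fun h => hz' (sphere_subset_closedBall h)).symm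
  · have hpi : (Real.pi : ℂ) ≠ 0 := by simp [Real.pi_ne_zero]
    have : 1 / (2 * (Real.pi : ℂ)) * (P + Q ξ + R ξ) - 1 / (2 * (Real.pi : ℂ)) * (M + Q ξ + R ξ) =
        1 / (2 * (Real.pi : ℂ)) * (P - M) := by ring
    rw [this, hPM]
    field_simp

/-- As T_0 = σ_j⁻¹ T_j, the distinguished reflection may be exchanged for the one fixing 𝔏_j at the
price of a constant. Automorphy is not needed. -/
theorem Phi1_eq {ζ : RSphere} (hζ : ζ ∈ S.pieces) (C₁ : ℝ) (j : Fin n) :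
    S.Phi1 ζs c a C₁ ζ = S.Psi1 ζs c a ζ + conj (S.Psi1 ζs c a (S.T j ζ)) +
      (C₁ - conj (S.Psi1 ζs c a (S.sigma j ζs))) := by
  have e : S.T 0 ζ = (S.sigma j)⁻¹ (S.T j ζ) := by
    rw [sigma_inv, Equiv.Perm.mul_apply, T_T]
  rw [Phi1, e, D.Psi1_inv_apply hζs c a (S.T_mem_pieces j hζ) (S.sigma_mem_schottky j), map_sub]
  ring

/-- The reflection `T j` swaps the two sides of the circle, so the total jump is J - conj J, with J
= i[Im(cξ) - a_j] the jump of Ψ₁; J is purely imaginary, hence it doubles. -/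
theorem Phi1_jump (C₁ : ℝ) {j : Fin n} {ξ : ℂ} (hξ : ξ ∈ S.circle j) :
    ∃ P M : ℂ, Tendsto (S.Phi1 ζs c a C₁) (𝓝[S.disc j] (ξ : RSphere)) (𝓝 P) ∧
      Tendsto (S.Phi1 ζs c a C₁) (𝓝[(S.closedDisc j)ᶜ] (ξ : RSphere)) (𝓝 M) ∧
      P - M = 2 * Complex.I * (((c * ξ).im - a j : ℝ) : ℂ) := by
  obtain ⟨P, M, hP, hM, hPM⟩ := D.Psi1_jump hζs c a hξ
  have hM' := (Complex.continuous_conj.tendsto _).comp (hM.comp (S.tendsto_T_interior hξ))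
  have hP' := (Complex.continuous_conj.tendsto _).comp (hP.comp (S.tendsto_T_exterior hξ))
  have hext := S.eventually_mem_exterior hξ
  refine ⟨_, _, ((hP.add hM').add_const (C₁ - conj (S.Psi1 ζs c a (S.sigma j ζs)))).congr' ?_,
    ((hM.add hP').add_const (C₁ - conj (S.Psi1 ζs c a (S.sigma j ζs)))).congr' ?_, ?_⟩
  · filter_upwards [nhdsWithin_le_nhds ((S.continuous_T j).tendsto' (ξ : RSphere) (ξ : RSphere)
      (S.T_coe_of_mem_circle hξ) |>.eventually hext), self_mem_nhdsWithin] with p hp hp'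
    have h3 := S.T_mem_pieces j (S.exterior_subset_pieces (hp (S.T_notMem_closedDisc hp')))
    rw [T_T] at h3
    exact (D.Phi1_eq hζs c a h3 C₁ j).symm
  · filter_upwards [nhdsWithin_le_nhds hext, self_mem_nhdsWithin] with p hp hp'
    exact (D.Phi1_eq hζs c a (S.exterior_subset_pieces (hp hp')) C₁ j).symm
  · have h1 : conj P - conj M = -(Complex.I * (((c * ξ).im - a j : ℝ) : ℂ)) := by
      rw [← map_sub, hPM, map_mul, Complex.conj_I, Complex.conj_ofReal]
      ring
    linear_combination hPM - h1

theorem sphereAnalyticOn_Phi1 (C₁ : ℝ) : SphereAnalyticOn (S.Phi1 ζs c a C₁) S.pieces := by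
  constructor
  · intro z hz
    have h1 := D.analyticAt_Psi1_smul hζs c a 1 (w := z) (by rwa [one_smul])
    have h2 := D.analyticAt_Psi1_smul hζs c a (reflectionGL (S.center 0) (S.radius_pos 0))
      (w := conj z) (by
        rw [← circleReflection_coe]
        exact S.T_mem_pieces 0 hz)
    have h3 := (h1.add h2.comp_conj_conj).add (analyticAt_const (v := (C₁ : ℂ)))
    refine h3.congr (Eventually.of_forall fun w => ?_)
    simp only [Pi.add_apply, one_smul, ← circleReflection_coe]
    rfl
  · intro _
    have h0 : coordInfty 0 = ∞ := by simp [coordInfty]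
    have h1 := D.analyticAt_Psi1_smul hζs c a inversionGL (w := 0) (by
      rw [inversionGL_smul, h0]
      exact S.infty_mem_pieces)
    have h2 := D.analyticAt_Psi1_smul hζs c a
      (reflectionGL (S.center 0) (S.radius_pos 0) * inversionGL)
      (w := conj 0) (by
        rw [← circleReflection_coordInfty, h0]
        exact S.T_mem_pieces 0 S.infty_mem_pieces)
    have h3 := (h1.add h2.comp_conj_conj).add (analyticAt_const (v := (C₁ : ℂ)))
    refine h3.congr (Eventually.of_forall fun w => ?_)
    simp only [Pi.add_apply, inversionGL_smul, ← circleReflection_coordInfty]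
    rfl

end MoebiusData

theorem exists_bound_of_analyticAt_infty {Φ : RSphere → ℂ}
    (h : AnalyticAt ℂ (fun w : ℂ => Φ (coordInfty w)) 0) :
    ∃ B R : ℝ, ∀ z : ℂ, R < ‖z‖ → ‖Φ (z : RSphere)‖ ≤ B := by
  have h1 := h.continuousAt.norm.eventually (gt_mem_nhds (lt_add_one _))
  obtain ⟨ε, hε, hb⟩ := Metric.eventually_nhds_iff.1 h1
  refine ⟨‖Φ (coordInfty 0)‖ + 1, ε⁻¹, fun z hz => ?_⟩
  have hz0 : 0 < ‖z‖ := (inv_pos.2 hε).trans hz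
  have hz1 : z ≠ 0 := norm_pos_iff.1 hz0
  have h2 := hb (y := z⁻¹) (by
    rw [dist_zero_right, norm_inv]
    exact inv_lt_of_inv_lt₀ hε hz)
  rw [coordInfty, if_neg (inv_ne_zero hz1), inv_inv] at h2
  exact h2.le

theorem MoebiusData.isRHSolution_Phi1 (D : S.MoebiusData) {ζs : RSphere}
    (hζs : ζs ∈ S.exterior) (c : ℂ) (a : Fin n → ℝ) (ha : S.ConstantsFormula ζs c a) (C₁ : ℝ) :
    S.IsRHSolution c a (S.Phi1 ζs c a C₁) := by
  have hs := S.exterior_subset_pieces hζs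
  have hauto := (D.isAutomorphic_Phi1_iff c a hζs C₁).2 ha
  have han := D.sphereAnalyticOn_Phi1 hs c a C₁
  refine ⟨han, hauto, exists_bound_of_analyticAt_infty (han.2 S.infty_mem_pieces), ?_, ?_⟩
  · rintro j _ ⟨q, hq, rfl⟩
    have hq' := S.exterior_subset_pieces hq
    -- Symmetry in 𝔏_0 is built into Φ₁; automorphy under σ_j = T_j T_0 transfers it to 𝔏_j.
    have h1 := hauto _ (S.sigma_mem_schottky j) _ (S.T_mem_pieces 0 (S.T_mem_pieces j hq'))
    have e : S.sigma j (S.T 0 (S.T j q)) = S.T j (S.T j q) := by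
      rw [sigma, Equiv.Perm.mul_apply, T_T]
    rw [e] at h1
    rw [h1, Phi1, Phi1, T_T, map_add, map_add, Complex.conj_conj, Complex.conj_ofReal]
    ring
  · intro j ξ hξ
    obtain ⟨P, M, hP, hM, hPM⟩ := D.Phi1_jump hs c a C₁ hξ
    exact ⟨P, M, S.tendsto_interior_iff.2 hP, S.tendsto_exterior_iff.2 hM, hPM⟩

end CircleSystem

namespace CircleSystem

open Set Filter Metric

/-! ### Real boundary values on the exterior domain. -/

section Exterior

variable {n : ℕ} (S : CircleSystem n)

theorem isPreconnected_exterior : IsPreconnected {z : ℂ | (z : RSphere) ∈ S.exterior} := by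
  have key : ∀ s : Finset (Fin n),
      IsPreconnected {z : ℂ | ∀ j ∈ s, S.radius j < dist z (S.center j)} ∧
        IsOpen {z : ℂ | ∀ j ∈ s, S.radius j < dist z (S.center j)} := by
    intro s
    induction s using Finset.induction_on with
    | empty =>
      simp only [Finset.notMem_empty, IsEmpty.forall_iff, implies_true]
      exact ⟨isPreconnected_univ, isOpen_univ⟩
    | insert j s hj ih =>
      have e : {z : ℂ | ∀ i ∈ insert j s, S.radius i < dist z (S.center i)} =
          {z : ℂ | ∀ i ∈ s, S.radius i < dist z (S.center i)} \
            closedBall (S.center j) (S.radius j) := by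
        ext z
        simp only [Finset.mem_insert, forall_eq_or_imp, mem_ofPred_eq, Set.mem_sdiff, mem_closedBall,
          not_le]
        exact and_comm
      rw [e]
      refine ⟨ih.1.diff_closedBall ih.2 (S.radius_pos j) fun z hz i hi => ?_,
        ih.2.sdiff isClosed_closedBall⟩
      have hij : i ≠ j := by
        rintro rfl
        exact hj hi
      exact not_le.1 fun h => disjoint_left.1 (S.disjoint hij) h hz
  have h := (key Finset.univ).1
  simp only [Finset.mem_univ, forall_const] at h
  simpa only [coe_mem_exterior_iff] using h

theorem nhdsWithin_compl_closedDisc_neBot {j : Fin n} {ξ : ℂ} (hξ : ξ ∈ S.circle j) :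
    (𝓝[(S.closedDisc j)ᶜ] (ξ : RSphere)).NeBot := by
  rw [OnePoint.nhdsWithin_coe, closedDisc, preimage_compl,
    preimage_image_eq _ OnePoint.coe_injective]
  have h1 : (𝓝[(closedBall (S.center j) (S.radius j))ᶜ] ξ).NeBot := by
    rw [← mem_closure_iff_nhdsWithin_neBot, closure_compl,
      interior_closedBall _ (S.radius_pos j).ne']
    exact fun h => (mem_ball.1 h).ne hξ
  exact h1.map _

theorem mem_exterior_or_of_notMem_disc {p : RSphere} (hp : ∀ j, p ∉ S.disc j) :
    p ∈ S.exterior ∨ ∃ j, ∃ ξ ∈ S.circle j, p = (ξ : RSphere) := by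
  by_cases h : p ∈ S.exterior
  · exact Or.inl h
  · right
    rw [mem_exterior_iff, not_forall] at h
    obtain ⟨j, hj⟩ := h
    rw [not_not] at hj
    obtain ⟨ξ, hξ, rfl⟩ := hj
    refine ⟨j, ξ, ?_, rfl⟩
    have := hp j
    rw [disc, coe_mem_image_coe, mem_ball, not_lt] at this
    exact le_antisymm hξ this

/-- The Möbius transformation `w ↦ z₀ + 1 / w`. -/
def shiftedInversionGL (z₀ : ℂ) : GL (Fin 2) ℂ :=
  Matrix.GeneralLinearGroup.mkOfDetNeZero !![z₀, 1; 1, 0] (by simp [Matrix.det_fin_two])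

theorem coe_shiftedInversionGL (z₀ : ℂ) :
    (shiftedInversionGL z₀ : Matrix (Fin 2) (Fin 2) ℂ) = !![z₀, 1; 1, 0] := rfl

theorem shiftedInversionGL_smul_infty (z₀ : ℂ) :
    shiftedInversionGL z₀ • (∞ : RSphere) = (z₀ : RSphere) := by
  rw [OnePoint.smul_infty_eq_ite, coe_shiftedInversionGL]
  simp

theorem shiftedInversionGL_smul_coe {z₀ w : ℂ} (hw : w ≠ 0) :
    shiftedInversionGL z₀ • (w : RSphere) = ((z₀ + w⁻¹ : ℂ) : RSphere) := by
  rw [OnePoint.smul_some_eq_ite, coe_shiftedInversionGL]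
  simp only [Matrix.of_apply, Matrix.cons_val', Matrix.cons_val_zero, Matrix.cons_val_one,
    Matrix.cons_val_fin_one, one_mul, add_zero, if_neg hw]
  refine OnePoint.coe_eq_coe.2 ?_
  field_simp

theorem isBounded_preimage_exterior (j : Fin n) :
    Bornology.IsBounded {w : ℂ | shiftedInversionGL (S.center j) • (w : RSphere) ∈ S.exterior} := by
  refine isBounded_closedBall.subset (t := closedBall 0 (S.radius j)⁻¹) fun w hw => ?_
  rw [mem_closedBall, dist_zero_right]
  by_cases h : w = 0
  · rw [h, norm_zero]
    exact (inv_pos.2 (S.radius_pos j)).le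
  · rw [mem_ofPred_eq, shiftedInversionGL_smul_coe h, coe_mem_exterior_iff] at hw
    have h1 := hw j
    rw [dist_eq_norm, add_sub_cancel_left, norm_inv] at h1
    exact le_inv_of_le_inv₀ (S.radius_pos j) h1.le

/-- A function on the exterior domain which is analytic and has real boundary values on all the
circles is a real constant. -/
theorem exists_eq_const_of_im_boundary_eq_zero [NeZero n] {F : RSphere → ℂ}
    (hF : SphereAnalyticOn F S.exterior)
    (hb : ∀ j, ∀ ξ ∈ S.circle j, ∃ M : ℂ,
      Tendsto F (𝓝[(S.closedDisc j)ᶜ] (ξ : RSphere)) (𝓝 M) ∧ M.im = 0) :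
    ∃ K : ℝ, ∀ p ∈ S.exterior, F p = (K : ℂ) := by
  -- Inversion about a point of a removed disc makes the exterior a bounded plane domain, as the
  -- maximum principle requires.
  set N := shiftedInversionGL (S.center 0) with hN
  set U : Set ℂ := {w : ℂ | N • (w : RSphere) ∈ S.exterior} with hU
  set h : ℂ → ℂ := fun w => F (N • (w : RSphere)) with hh
  have hcN := continuous_smul_coe N
  have hUo : IsOpen U := S.isOpen_exterior.preimage hcN
  have hUb : Bornology.IsBounded U := S.isBounded_preimage_exterior 0
  have han : ∀ w ∈ U, AnalyticAt ℂ h w := fun w hw => hF.analyticAt_smul N hw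
  have hcl : ∀ w ∈ closure U, w ∈ U ∨
      ∃ M : ℂ, Tendsto h (𝓝[U] w) (𝓝 M) ∧ M.im = 0 := by
    intro w hw
    have h1 : ∀ j, N • (w : RSphere) ∉ S.disc j := by
      intro j
      have hc : IsClosed {w : ℂ | N • (w : RSphere) ∉ S.disc j} :=
        ((OnePoint.isOpenMap_coe _ isOpen_ball).preimage hcN).isClosed_compl
      refine closure_minimal (fun v hv => ?_) hc hw
      exact fun h' => S.mem_exterior_iff.1 hv j (S.disc_subset_closedDisc j h')
    rcases S.mem_exterior_or_of_notMem_disc h1 with h2 | ⟨j, ξ, hξ, e⟩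
    · exact Or.inl h2
    · right
      obtain ⟨M, hM, hM0⟩ := hb j ξ hξ
      refine ⟨M, hM.comp (tendsto_nhdsWithin_of_tendsto_nhds_of_eventually_within _ ?_ ?_), hM0⟩
      · rw [← e]
        exact (hcN.tendsto w).mono_left nhdsWithin_le_nhds
      · filter_upwards [self_mem_nhdsWithin] with v hv using S.mem_exterior_iff.1 hv j
  set f : ℂ → ℂ := extendFrom U h with hf
  have hfU : ∀ w ∈ U, f w = h w := fun w hw =>
    extendFrom_eq (subset_closure hw) ((han w hw).continuousAt.tendsto.mono_left nhdsWithin_le_nhds)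
  have hfc : ContinuousOn f (closure U) := by
    refine continuousOn_extendFrom le_rfl fun w hw => ?_
    rcases hcl w hw with h1 | ⟨M, hM, -⟩
    · exact ⟨h w, (han w h1).continuousAt.tendsto.mono_left nhdsWithin_le_nhds⟩
    · exact ⟨M, hM⟩
  have hfd : DiffContOnCl ℂ f U := by
    refine ⟨fun w hw => ?_, hfc⟩
    refine ((han w hw).differentiableAt.congr_of_eventuallyEq ?_).differentiableWithinAt
    filter_upwards [hUo.mem_nhds hw] with v hv using hfU v hv
  have hfr : ∀ w ∈ frontier U, (f w).im = 0 := by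
    intro w hw
    rw [hUo.frontier_eq] at hw
    rcases hcl w hw.1 with h1 | ⟨M, hM, hM0⟩
    · exact absurd h1 hw.2
    · rw [hf, extendFrom_eq hw.1 hM, hM0]
  -- For imaginary s, exp(s f) has modulus exp(-Im s · Im f), which is 1 on the frontier. Taking s =
  -- i and s = -i bounds Im f by 0 from both sides.
  have hexp : ∀ s : ℂ, s.re = 0 → ∀ w ∈ U, -(s.im * (f w).im) ≤ 0 := by
    intro s hs w hw
    have hd : DiffContOnCl ℂ (fun w => Complex.exp (s * f w)) U :=
      Complex.differentiable_exp.comp_diffContOnCl (hfd.const_smul s)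
    have hn : ∀ w, ‖Complex.exp (s * f w)‖ = Real.exp (-(s.im * (f w).im)) := by
      intro w
      rw [Complex.norm_exp, Complex.mul_re, hs]
      congr 1
      ring
    have h1 := Complex.norm_le_of_forall_mem_frontier_norm_le hUb hd (C := 1)
      (fun z hz => by rw [hn, hfr z hz]; simp) (subset_closure hw)
    rw [hn] at h1
    exact Real.exp_le_one_iff.1 h1
  have him : ∀ w ∈ U, (h w).im = 0 := by
    intro w hw
    have h1 := hexp Complex.I (by simp) w hw
    have h2 := hexp (-Complex.I) (by simp) w hw
    simp only [Complex.I_im, Complex.neg_im, one_mul, neg_mul, neg_neg] at h1 h2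
    rw [← hfU w hw]
    linarith
  have hFim : ∀ p ∈ S.exterior, (F p).im = 0 := by
    intro p hp
    obtain ⟨q, rfl⟩ : ∃ q : RSphere, p = N • q := ⟨N⁻¹ • p, by rw [smul_inv_smul]⟩
    induction q using OnePoint.rec with
    | infty =>
      rw [hN, shiftedInversionGL_smul_infty, coe_mem_exterior_iff] at hp
      have := hp 0
      rw [dist_self] at this
      exact absurd this (S.radius_pos 0).not_gt
    | coe w => exact him w hp
  have hanE : AnalyticOnNhd ℂ (fun z : ℂ => F (z : RSphere))
      {z : ℂ | (z : RSphere) ∈ S.exterior} := fun z hz => hF.1 z hz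
  have hEo : IsOpen {z : ℂ | (z : RSphere) ∈ S.exterior} :=
    S.isOpen_exterior.preimage OnePoint.continuous_coe
  have hcont := (hF.2 S.infty_mem_exterior).continuousAt
  have h0 : coordInfty 0 = ∞ := by simp [coordInfty]
  have hevE : ∀ᶠ w : ℂ in 𝓝[≠] 0, w⁻¹ ∈ {z : ℂ | (z : RSphere) ∈ S.exterior} := by
    have h1 : ∀ᶠ w : ℂ in 𝓝 0, coordInfty w ∈ S.exterior :=
      continuous_coordInfty.continuousAt.eventually_mem
        (S.isOpen_exterior.mem_nhds (by rw [h0]; exact S.infty_mem_exterior))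
    filter_upwards [nhdsWithin_le_nhds h1, self_mem_nhdsWithin] with w hw hw0
    rwa [coordInfty, if_neg (show w ≠ 0 from hw0)] at hw
  have hconst : ∃ K : ℂ, ∀ z : ℂ, (z : RSphere) ∈ S.exterior → F (z : RSphere) = K := by
    -- Open mapping: a nonconstant `F` would have an open image, yet the image is real; a value
    -- shifted by iε/2 is the contradiction.
    rcases hanE.is_constant_or_isOpen S.isPreconnected_exterior with h1 | h1
    · exact h1
    · exfalso
      have h2 := h1 _ subset_rfl hEo
      obtain ⟨w, hw⟩ := hevE.exists
      obtain ⟨ε, hε, hball⟩ := Metric.isOpen_iff.1 h2 _ (mem_image_of_mem _ hw)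
      have h3 : F ((w⁻¹ : ℂ) : RSphere) + ((ε / 2 : ℝ) : ℂ) * Complex.I ∈
          ball (F ((w⁻¹ : ℂ) : RSphere)) ε := by
        rw [mem_ball, dist_eq_norm, add_sub_cancel_left, norm_mul, Complex.norm_I, mul_one,
          Complex.norm_real, Real.norm_of_nonneg (by positivity)]
        linarith
      obtain ⟨z, hz, e⟩ := hball h3
      have h4 := hFim _ hz
      simp only at e
      rw [e, Complex.add_im, hFim _ hw, Complex.im_ofReal_mul, Complex.I_im] at h4
      linarith
  obtain ⟨K, hK⟩ := hconst
  have hinf : F ∞ = K := by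
    have h1 : Tendsto (fun w : ℂ => F (coordInfty w)) (𝓝[≠] 0) (𝓝 (F ∞)) := by
      have := hcont.tendsto
      rw [h0] at this
      exact this.mono_left nhdsWithin_le_nhds
    refine tendsto_nhds_unique h1 (tendsto_const_nhds.congr' ?_)
    filter_upwards [hevE, self_mem_nhdsWithin] with w hw hw0
    rw [coordInfty, if_neg (show w ≠ 0 from hw0), hK _ hw]
  have hK0 : K.im = 0 := by
    rw [← hinf]
    exact hFim _ S.infty_mem_exterior
  have hK1 : ((K.re : ℝ) : ℂ) = K := Complex.ext (by simp) (by simp [hK0])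
  refine ⟨K.re, fun p hp => ?_⟩
  rw [hK1]
  induction p using OnePoint.rec with
  | infty => exact hinf
  | coe z => exact hK z hp

end Exterior

/-! ### Uniqueness up to a real constant. -/

section Uniqueness

variable {n : ℕ} [NeZero n] {S : CircleSystem n} {c : ℂ} {a : Fin n → ℝ} {Φ Φ' : RSphere → ℂ}

theorem IsRHSolution.apply_T_of_mem_exterior (h : S.IsRHSolution c a Φ) (j : Fin n) {p : RSphere}
    (hp : p ∈ S.exterior) : Φ (S.T j p) = conj (Φ p) := by
  have := h.symmetric j (S.T j p) ⟨p, hp, rfl⟩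
  rw [T_T] at this
  exact this.symm

/-- Symmetry forces the inner boundary value to be conj M, so the jump conj M - M = -2i Im M
determines Im M. -/
theorem IsRHSolution.exists_tendsto_exterior (h : S.IsRHSolution c a Φ) {j : Fin n} {ξ : ℂ}
    (hξ : ξ ∈ S.circle j) : ∃ M : ℂ,
      Tendsto Φ (𝓝[(S.closedDisc j)ᶜ] (ξ : RSphere)) (𝓝 M) ∧ M.im = -((c * ξ).im - a j) := by
  obtain ⟨P, M, hP, hM, hPM⟩ := h.jump j ξ hξ
  rw [S.tendsto_interior_iff] at hP
  rw [S.tendsto_exterior_iff] at hM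
  refine ⟨M, hM, ?_⟩
  have := S.nhdsWithin_compl_closedDisc_neBot hξ
  have h1 : P = conj M := by
    refine tendsto_nhds_unique (hP.comp (S.tendsto_T_exterior hξ))
      (((Complex.continuous_conj.tendsto _).comp hM).congr' ?_)
    filter_upwards [nhdsWithin_le_nhds (S.eventually_mem_exterior hξ), self_mem_nhdsWithin]
      with p hp hp'
    exact (h.apply_T_of_mem_exterior j (hp hp')).symm
  rw [h1] at hPM
  have h2 := congrArg Complex.im hPM
  simp only [Complex.sub_im, Complex.conj_im, Complex.mul_im, Complex.mul_re, Complex.re_ofNat,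
    Complex.im_ofNat, Complex.I_re, Complex.I_im, Complex.ofReal_re, Complex.ofReal_im] at h2
  simp only [Complex.mul_im]
  linarith

/-- The difference is a real constant on the exterior. Automorphy spreads it over one coset of the
reflection group; the other also needs a conjugation, harmless because the constant is real. -/
theorem IsRHSolution.exists_eq_add_const (h : S.IsRHSolution c a Φ)
    (h' : S.IsRHSolution c a Φ') : ∃ K : ℝ, ∀ ζ ∈ S.pieces, Φ ζ = Φ' ζ + (K : ℂ) := by
  have hE := S.exterior_subset_pieces
  obtain ⟨K, hK⟩ := S.exists_eq_const_of_im_boundary_eq_zero (F := fun p => Φ p - Φ' p)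
    ⟨fun z hz => (h.analytic.1 z (hE hz)).sub (h'.analytic.1 z (hE hz)),
      fun hz => (h.analytic.2 (hE hz)).sub (h'.analytic.2 (hE hz))⟩ (by
    intro j ξ hξ
    obtain ⟨M, hM, hM0⟩ := h.exists_tendsto_exterior hξ
    obtain ⟨M', hM', hM0'⟩ := h'.exists_tendsto_exterior hξ
    exact ⟨M - M', hM.sub hM', by rw [Complex.sub_im, hM0, hM0', sub_self]⟩)
  refine ⟨K, fun ζ hζ => ?_⟩
  rw [← sub_eq_iff_eq_add']
  obtain ⟨g, hg, q, hq, rfl⟩ := S.mem_pieces_iff.1 hζ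
  rcases S.mem_schottky_or_of_mem_reflectionGroup hg with hs | hs
  · rw [h.automorphic g hs q (hE hq), h'.automorphic g hs q (hE hq)]
    exact hK q hq
  · have hT := S.T_mem_pieces 0 (hE hq)
    have e : g q = (g * S.T 0) (S.T 0 q) := by rw [Equiv.Perm.mul_apply, T_T]
    rw [e, h.automorphic _ hs _ hT, h'.automorphic _ hs _ hT, h.apply_T_of_mem_exterior 0 hq,
      h'.apply_T_of_mem_exterior 0 hq, ← map_sub, hK q hq, Complex.conj_ofReal]

end Uniqueness

end CircleSystem

end

theorem mainTheorem2 {n : ℕ} [NeZero n] (S : CircleSystem n) (hS : S.FirstClass)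
    (ζs : RSphere) (hζs : ζs ∈ S.exterior) (c : ℂ) :
    -- the kernel series converges absolutely and the integrals exist
    (∀ ζ ∈ S.pieces, ∀ l : Fin n,
      (∀ η ∈ S.circle l, Summable (S.kernelTerm ζs ζ η)) ∧
      CircleIntegrable (S.kernel ζs ζ) (S.center l) (S.radius l)) ∧
    -- the kernel is quasiautomorphic
    (∀ σ ∈ S.schottky, ∀ ζ ∈ S.pieces, ∀ l : Fin n, ∀ η ∈ S.circle l,
      S.kernel ζs (σ ζ) η = S.kernel ζs ζ η + S.chi ζs σ η) ∧
    -- the residue integrals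
    (∀ j : Fin n, j ≠ 0 →
      (∮ η in C(S.center 0, S.radius 0), S.chi ζs (S.sigma j) η) =
        -(2 * (Real.pi : ℂ) * Complex.I)) ∧
    (∀ j l : Fin n, j ≠ 0 → l ≠ 0 →
      (∮ η in C(S.center l, S.radius l), S.chi ζs (S.sigma j) η) =
        if l = j then 2 * (Real.pi : ℂ) * Complex.I else 0) ∧
    -- automorphicity of the function is equivalent to the formulas for the constants
    (∀ (a : Fin n → ℝ) (C₁ : ℝ),
      S.IsAutomorphic (S.Phi1 ζs c a C₁) ↔ S.ConstantsFormula ζs c a) ∧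
    -- the constant with index zero is free and determines the others
    (∀ a₀ : ℝ, ∃! a : Fin n → ℝ, a 0 = a₀ ∧ S.ConstantsFormula ζs c a) ∧
    -- general solution of the Riemann–Hilbert problem
    (∀ a : Fin n → ℝ, S.ConstantsFormula ζs c a →
      (∀ C₁ : ℝ, S.IsRHSolution c a (S.Phi1 ζs c a C₁)) ∧
      (∀ Φ : RSphere → ℂ, S.IsRHSolution c a Φ →
        ∃ C₁ : ℝ, ∀ ζ ∈ S.pieces, Φ ζ = S.Phi1 ζs c a C₁ ζ)) := by
  obtain ⟨D⟩ := hS.nonempty_moebiusData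
  have hs := S.exterior_subset_pieces hζs
  refine ⟨fun ζ hζ l => ⟨fun η hη => D.summable_kernelTerm hs hζ hη, ?_⟩,
    fun σ hσ ζ hζ l η hη => D.kernel_apply hs hζ hσ hη, fun j hj => ?_, fun j l hj hl => ?_,
    fun a C₁ => D.isAutomorphic_Phi1_iff c a hζs C₁, fun a₀ => ?_, fun a ha =>
    ⟨D.isRHSolution_Phi1 hζs c a ha, fun Φ hΦ => ?_⟩⟩
  · exact (D.continuousOn_kernel hs hζ l).circleIntegrable (S.radius_pos l).le
  · rw [D.circleIntegral_chi hζs hj, if_neg hj.symm, if_pos rfl, zero_sub]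
  · rw [D.circleIntegral_chi hζs hj, if_neg hl, sub_zero]
  · refine ⟨fun j => if j = 0 then a₀ else a₀ + 1 / (2 * Real.pi) *
      (∑ l, ∮ η in C(S.center l, S.radius l),
        (((c * η).im : ℝ) : ℂ) * S.chi ζs (S.sigma j) η).im, ⟨if_pos rfl, fun j hj => ?_⟩, ?_⟩
    · simp only [if_neg hj, if_true]
    · rintro b ⟨hb0, hb⟩
      ext j
      by_cases hj : j = 0
      · simp only [hj, if_true, hb0]
      · rw [hb j hj, hb0]
        simp only [if_neg hj]
  · obtain ⟨K, hK⟩ := hΦ.exists_eq_add_const (D.isRHSolution_Phi1 hζs c a ha 0)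
    refine ⟨K, fun ζ hζ => ?_⟩
    rw [hK ζ hζ, CircleSystem.Phi1, CircleSystem.Phi1, Complex.ofReal_zero, add_zero]
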